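/- Let $P$ be the law of a random environment $\omega=(Z_k,E_k)_{k\in\mathbb Z}$ with $Z_k\in(0,\infty)$ and $E_k\in\mathbb R$, and let $\mathbb E$ be the expectation with respect to $P$. For $\ell\in\mathbb Z$ put $\tau_\ell\omega=(Z_{k+\ell},E_{k+\ell})_{k\in\mathbb Z}$. Assume that (A1) the sequence $(Z_k,E_k)_{k\in\mathbb Z}$ is stationary and ergodic with respect to shifts; (A2) $\mathbb E[Z_0]<\infty$; (A3) $P(\omega=\tau_\ell\omega)=0$ for all $\ell\in\mathbb Z\setminus\{0\}$; (A4) there is $d>0$ with $P(Z_0\ge d)=1$. Let $x_0=0$ and $x_{k+1}=x_k+Z_k$ for $k\in\mathbb Z$, let $u:\mathbb R\times\mathbb R\to\mathbb R$ be symmetric, bounded and measurable, and let $\lambda\in[0,1)$. Set $c_{i,i}(\omega)=0$ and $$c_{i,j}(\omega)=\exp\{\lambda(x_i+x_j)-|x_j-x_i|+u(E_i,E_j)\},\qquad i\ne j\in\mathbb Z .$$ Given $\omega$, let $(X^1_n)_{n\ge 0}$ be the discrete-time Markov chain on $\mathbb Z$, started at $0$, with law $P^{\omega,1}_0$, that jumps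 in one step from $i$ to $j$ with probability $c_{i,j}(\omega)/\sum_{k\in\mathbb Z}c_{i,k}(\omega)$ if $|i-j|=1$, with probability $0$ if $|i-j|>1$, and that stays at $i$ with the remaining probability $1-\sum_{j:|j-i|=1}c_{i,j}(\omega)/\sum_{k\in\mathbb Z}c_{i,k}(\omega)$. Then there is a deterministic number $v=v_{X^1}(\lambda)\in\mathbb R$, not depending on $\omega$, such that for $P$-almost every $\omega$ $$\lim_{n\to\infty}\frac{X^1_n}{n}=v\qquad P^{\omega,1}_0\text{-almost surely.}$$ Moreover, $v>0$ if and only if $$\mathbb E\Bigl[\,\sum_{i=1}^{\infty}\exp\bigl\{(1-\lambda)Z_0-(1+\lambda)Z_{-i}-2\lambda(Z_{-i+1}+\dots+Z_{-1})\bigr\}\Bigr]<\infty ,$$ where for $i=1$ the last sum in the exponent is empty, and otherwise $v=0$. -/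

import Mathlib

open MeasureTheory ProbabilityTheory Filter Topology
open scoped ENNReal

namespace MottWalk

/-- The space of environments `ω = (Z_k, E_k)_{k ∈ ℤ}` with `Z_k ∈ (0, ∞)` and `E_k ∈ ℝ`,
with the product σ-algebra. -/
abbrev Env : Type := ℤ → Set.Ioi (0 : ℝ) × ℝ

/-- The distance `Z_k` between the points `x_k` and `x_{k+1}`. -/
def gap (ω : Env) (k : ℤ) : ℝ := ((ω k).1 : ℝ)

/-- The energy mark `E_k` of the point `x_k`. -/
def mark (ω : Env) (k : ℤ) : ℝ := (ω k).2

/-- The shifted environment `τ_ℓ ω = (Z_{k+ℓ}, E_{k+ℓ})_{k ∈ ℤ}`. -/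
def shift (l : ℤ) (ω : Env) : Env := fun k => ω (k + l)

/-- The points `x_k`: `x_0 = 0` and `x_{k+1} = x_k + Z_k` (see `pos_zero` and `pos_succ`). -/
noncomputable def pos (ω : Env) (k : ℤ) : ℝ :=
  ∑ j ∈ Finset.Ico 0 k, gap ω j - ∑ j ∈ Finset.Ico k 0, gap ω j

theorem pos_zero (ω : Env) : pos ω 0 = 0 := by
  simp [pos]

theorem pos_succ (ω : Env) (k : ℤ) : pos ω (k + 1) = pos ω k + gap ω k := by
  unfold pos
  rcases le_or_gt 0 k with h | h
  · rw [Finset.Ico_eq_empty_of_le h, Finset.Ico_eq_empty_of_le (by omega : (0 : ℤ) ≤ k + 1)]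
    have hs : Finset.Ico (0 : ℤ) (k + 1) = insert k (Finset.Ico 0 k) := by
      ext a; simp only [Finset.mem_Ico, Finset.mem_insert]; omega
    rw [hs, Finset.sum_insert (by simp)]
    simp [add_comm]
  · rw [Finset.Ico_eq_empty_of_le (by omega : k ≤ 0),
      Finset.Ico_eq_empty_of_le (by omega : k + 1 ≤ 0)]
    have hs : Finset.Ico k 0 = insert k (Finset.Ico (k + 1) 0) := by
      ext a; simp only [Finset.mem_Ico, Finset.mem_insert]; omega
    rw [hs, Finset.sum_insert (by simp)]
    simp

/-- The standing assumptions on the law `P` of the environment. -/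
structure IsEnvLaw (P : Measure Env) : Prop where
  isProbabilityMeasure : IsProbabilityMeasure P
  /-- `P` is stationary and ergodic with respect to shifts
  (`Ergodic` includes that the shift preserves `P`). -/
  ergodic : Ergodic (shift 1) P
  /-- `Z_0` has finite expectation. -/
  integrable_gap : Integrable (fun ω => gap ω 0) P
  /-- The environment is almost surely not periodic. -/
  aperiodic : ∀ l : ℤ, l ≠ 0 → P {ω | ω = shift l ω} = 0
  /-- The distances between the points are uniformly bounded from below. -/
  gap_ge : ∃ d : ℝ, 0 < d ∧ P {ω | d ≤ gap ω 0} = 1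

/-- The conductances `c_{i,j}(ω) = exp(λ (x_i + x_j) - |x_j - x_i| + u(E_i, E_j))` for `i ≠ j`, and
`c_{i,i}(ω) = 0`. -/
noncomputable def conductance (u : ℝ → ℝ → ℝ) (lam : ℝ) (ω : Env) (i j : ℤ) : ℝ :=
  if i = j then 0
  else Real.exp (lam * (pos ω i + pos ω j) - |pos ω j - pos ω i| + u (mark ω i) (mark ω j))

theorem conductance_nonneg (u : ℝ → ℝ → ℝ) (lam : ℝ) (ω : Env) (i j : ℤ) :
    0 ≤ conductance u lam ω i j := by
  unfold conductance
  split_ifs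
  · exact le_rfl
  · exact (Real.exp_pos _).le

/-- The probability that the walk without truncation jumps from `i` to `j`,
`c_{i,j}(ω) / ∑_{k ∈ ℤ} c_{i,k}(ω)`. The series converges for all environments whose distances
`Z_k` are bounded from below by a positive constant (if `u` is bounded and `0 ≤ λ < 1`). -/
noncomputable def fullJumpProb (u : ℝ → ℝ → ℝ) (lam : ℝ) (ω : Env) (i j : ℤ) : ℝ :=
  conductance u lam ω i j / ∑' k : ℤ, conductance u lam ω i k

/-- The probability that the `ρ`-truncated walk `X^ρ` jumps from `i` to `j` in one step: jumps of
length larger than `ρ` are suppressed, and the walk stays put instead. -/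
noncomputable def jumpProb (u : ℝ → ℝ → ℝ) (lam : ℝ) (ρ : ℕ) (ω : Env) (i j : ℤ) : ℝ :=
  if i = j then 1 - ∑ k ∈ Finset.Icc (i - ρ) (i + ρ), fullJumpProb u lam ω i k
  else if |i - j| ≤ (ρ : ℤ) then fullJumpProb u lam ω i j
  else 0

theorem fullJumpProb_nonneg (u : ℝ → ℝ → ℝ) (lam : ℝ) (ω : Env) (i j : ℤ) :
    0 ≤ fullJumpProb u lam ω i j :=
  div_nonneg (conductance_nonneg u lam ω i j)
    (tsum_nonneg fun k => conductance_nonneg u lam ω i k)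

theorem sum_fullJumpProb_le_one (u : ℝ → ℝ → ℝ) (lam : ℝ) (ω : Env) (i : ℤ) (s : Finset ℤ) :
    ∑ k ∈ s, fullJumpProb u lam ω i k ≤ 1 := by
  unfold fullJumpProb
  rw [← Finset.sum_div]
  by_cases h : Summable fun k : ℤ => conductance u lam ω i k
  · exact div_le_one_of_le₀ (h.sum_le_tsum s fun k _ => conductance_nonneg u lam ω i k)
      (tsum_nonneg fun k => conductance_nonneg u lam ω i k)
  · rw [tsum_eq_zero_of_not_summable h]
    simp

theorem jumpProb_nonneg (u : ℝ → ℝ → ℝ) (lam : ℝ) (ρ : ℕ) (ω : Env) (i j : ℤ) :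
    0 ≤ jumpProb u lam ρ ω i j := by
  unfold jumpProb
  split_ifs
  · exact sub_nonneg.2 (sum_fullJumpProb_le_one u lam ω i _)
  · exact fullJumpProb_nonneg u lam ω i j
  · exact le_rfl

theorem sum_jumpProb (u : ℝ → ℝ → ℝ) (lam : ℝ) (ρ : ℕ) (ω : Env) (i : ℤ) :
    ∑ j ∈ Finset.Icc (i - ρ) (i + ρ), jumpProb u lam ρ ω i j = 1 := by
  have hi : i ∈ Finset.Icc (i - (ρ : ℤ)) (i + ρ) := by simp
  rw [← Finset.add_sum_erase _ _ hi]
  have h1 : ∑ j ∈ (Finset.Icc (i - (ρ : ℤ)) (i + ρ)).erase i, jumpProb u lam ρ ω i j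
      = ∑ j ∈ (Finset.Icc (i - (ρ : ℤ)) (i + ρ)).erase i, fullJumpProb u lam ω i j := by
    refine Finset.sum_congr rfl fun j hj => ?_
    have hj' := Finset.mem_erase.1 hj
    have hm := Finset.mem_Icc.1 hj'.2
    have ha : |i - j| ≤ (ρ : ℤ) := abs_le.2 ⟨by omega, by omega⟩
    simp [jumpProb, Ne.symm hj'.1, ha]
  have h2 : fullJumpProb u lam ω i i = 0 := by simp [fullJumpProb, conductance]
  rw [h1, ← zero_add (∑ j ∈ (Finset.Icc (i - (ρ : ℤ)) (i + ρ)).erase i, fullJumpProb u lam ω i j),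
    ← h2, Finset.add_sum_erase _ _ hi]
  simp [jumpProb]

/-- The one-step distribution of the `ρ`-truncated walk at the site `i`. -/
noncomputable def stepPMF (u : ℝ → ℝ → ℝ) (lam : ℝ) (ρ : ℕ) (ω : Env) (i : ℤ) : PMF ℤ :=
  PMF.ofFinset (fun j => ENNReal.ofReal (jumpProb u lam ρ ω i j))
    (Finset.Icc (i - ρ) (i + ρ))
    (by
      rw [← ENNReal.ofReal_sum_of_nonneg fun j _ => jumpProb_nonneg u lam ρ ω i j,
        sum_jumpProb, ENNReal.ofReal_one])
    (by
      intro j hj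
      have h1 : i ≠ j := by
        rintro rfl
        exact hj (by simp)
      have h2 : ¬ |i - j| ≤ (ρ : ℤ) := by
        intro h
        have := abs_le.1 h
        exact hj (Finset.mem_Icc.2 ⟨by omega, by omega⟩)
      simp [jumpProb, h1, h2])

/-- The transition kernel of the `ρ`-truncated walk: the law of the position at time `n + 1` given
the positions up to time `n`, which depends on the position at time `n` only. -/
noncomputable def stepKernel (u : ℝ → ℝ → ℝ) (lam : ℝ) (ρ : ℕ) (ω : Env) (n : ℕ) :
    Kernel (Finset.Iic n → ℤ) ℤ :=
  Kernel.ofFunOfCountable fun h =>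
    (stepPMF u lam ρ ω (h ⟨n, Finset.mem_Iic.2 le_rfl⟩)).toMeasure

instance (u : ℝ → ℝ → ℝ) (lam : ℝ) (ρ : ℕ) (ω : Env) (n : ℕ) :
    IsMarkovKernel (stepKernel u lam ρ ω n) :=
  ⟨fun h => PMF.toMeasure.isProbabilityMeasure
    (stepPMF u lam ρ ω (h ⟨n, Finset.mem_Iic.2 le_rfl⟩))⟩

/-- The quenched law `P_i^{ω,ρ}` on trajectories `ℕ → ℤ` of the `ρ`-truncated walk `X^ρ` with
environment `ω`: the law of the Markov chain with the above transition probabilities that starts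
at `i`. -/
noncomputable def walkLaw (u : ℝ → ℝ → ℝ) (lam : ℝ) (ρ : ℕ) (ω : Env) (i : ℤ) :
    Measure (ℕ → ℤ) :=
  Kernel.traj (X := fun _ => ℤ) (stepKernel u lam ρ ω) 0 (fun _ => i)

/-- The expectation under `P` of
`∑_{i ≥ 1} exp((1-λ) Z_0 - (1+λ) Z_{-i} - 2 λ (Z_{-i+1} + ⋯ + Z_{-1}))`, in `[0, ∞]`. -/
noncomputable def meanSeries (P : Measure Env) (lam : ℝ) : ℝ≥0∞ :=
  ∫⁻ ω, ∑' i : {i : ℕ // 1 ≤ i}, ENNReal.ofReal (Real.exp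
    ((1 - lam) * gap ω 0 - (1 + lam) * gap ω (-((i : ℕ) : ℤ))
      - 2 * lam * ∑ j ∈ Finset.Ico 1 (i : ℕ), gap ω (-(j : ℤ)))) ∂P

end MottWalk

/-! The truncated walk is a nearest-neighbour chain that is reversible with respect to
`totalConductance`, so the mean time to cross from `0` to `1` is an explicit series, `rightTime`.
The speed turns out to be the inverse of its mean over the environment, with inverse `0` when the
mean is infinite.

Upper bound (`IsEnvLaw.ae_integral_mul_walk_le`, `ae_mul_walk_le`): capping the crossing times in
the recursion that they satisfy gives a bounded function `g` of the environment whose cocycle has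
drift at most one along the walk. An exponential supermartingale estimate shows that the cocycle at
`X n` is at most `(1 + ε) n + C`. By Birkhoff's theorem the cocycle at `k` is close to `k` times the
mean of `g`, and that mean can be brought arbitrarily close to the mean of `rightTime`, or made
arbitrarily large if the latter is infinite. The mirrored argument with `leftTime` bounds the speed
to the left. Since the bias is to the right, `leftTime` always has infinite mean, so the walk never
has negative speed.

Lower bound when the mean `V` of `rightTime` is finite (`ae_tendsto_of_rightTime_lt_top`): the
environment seen from the walker has an invariant measure with density `visitDensity`, of total mass
`V`. A unit current flows through every edge, so the mean displacement in one step under this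
measure is `1`. No ergodicity of this process is needed: by the maximal ergodic lemma, averages that
are almost surely asymptotically at most their mean `1 / V` must also be at least that
(`ae_le_birkhoffSum_of_ae_birkhoffSum_le`). The density is positive, so the limit transfers back to
`P`.

Finally, conductances decay geometrically with the number of sites jumped over, so
`totalConductance` is comparable to the two adjacent nearest-neighbour conductances. Hence
`rightTime` has finite mean exactly when `meanSeries` is finite (`lintegral_rightTime_lt_top_iff`).
-/

namespace MottWalk

/-! ### Maximal ergodic lemma and Birkhoff's theorem with linear error bounds. -/

section ErgodicTheory

variable {α : Type*}

/-- The maximum of the Birkhoff sums of length at most `N`. -/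
noncomputable def maxBirkhoffSum (T : α → α) (f : α → ℝ) : ℕ → α → ℝ
  | 0, _ => 0
  | N + 1, x => max 0 (f x + maxBirkhoffSum T f N (T x))

theorem maxBirkhoffSum_nonneg (T : α → α) (f : α → ℝ) (N : ℕ) (x : α) :
    0 ≤ maxBirkhoffSum T f N x := by
  cases N with
  | zero => exact le_rfl
  | succ N => exact le_max_left _ _

theorem maxBirkhoffSum_le_succ (T : α → α) (f : α → ℝ) (N : ℕ) (x : α) :
    maxBirkhoffSum T f N x ≤ maxBirkhoffSum T f (N + 1) x := by
  induction N generalizing x with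
  | zero => exact maxBirkhoffSum_nonneg T f 1 x
  | succ N ih => exact max_le_max le_rfl (add_le_add le_rfl (ih (T x)))

theorem birkhoffSum_le_maxBirkhoffSum (T : α → α) (f : α → ℝ) (N : ℕ) (x : α) :
    birkhoffSum T f N x ≤ maxBirkhoffSum T f N x := by
  induction N generalizing x with
  | zero => simp [maxBirkhoffSum]
  | succ N ih =>
    rw [birkhoffSum_succ']
    exact (add_le_add le_rfl (ih (T x))).trans (le_max_right _ _)

/-- The points whose Birkhoff sums are not bounded above. -/
def unboundedSet (T : α → α) (f : α → ℝ) : Set α :=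
  {x | ∀ K : ℕ, ∃ n, (K : ℝ) < birkhoffSum T f n x}

/-- The Birkhoff sums at `x` and at `T x` differ by `f x` and an index shift, so the invariance is
exact and not merely almost sure. -/
theorem preimage_unboundedSet (T : α → α) (f : α → ℝ) :
    T ⁻¹' unboundedSet T f = unboundedSet T f := by
  ext x
  simp only [unboundedSet, Set.mem_preimage, Set.mem_ofPred_eq]
  constructor
  · intro h K
    obtain ⟨K', hK'⟩ := exists_nat_ge ((K : ℝ) - f x)
    obtain ⟨n, hn⟩ := h K'
    exact ⟨n + 1, by rw [birkhoffSum_succ']; linarith⟩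
  · intro h K
    obtain ⟨K', hK'⟩ := exists_nat_ge ((K : ℝ) + |f x|)
    obtain ⟨n, hn⟩ := h K'
    cases n with
    | zero =>
      rw [birkhoffSum_zero] at hn
      exact absurd hn (not_lt.2 (Nat.cast_nonneg K'))
    | succ n =>
      rw [birkhoffSum_succ'] at hn
      exact ⟨n, by linarith [le_abs_self (f x)]⟩

theorem birkhoffSum_sub_const (T : α → α) (f : α → ℝ) (c : ℝ) (n : ℕ) (x : α) :
    birkhoffSum T (fun y => f y - c) n x = birkhoffSum T f n x - n * c := by
  simp [birkhoffSum, Finset.sum_sub_distrib]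

theorem birkhoffSum_const_sub (T : α → α) (f : α → ℝ) (c : ℝ) (n : ℕ) (x : α) :
    birkhoffSum T (fun y => c - f y) n x = n * c - birkhoffSum T f n x := by
  simp [birkhoffSum, Finset.sum_sub_distrib]

variable [MeasurableSpace α] {μ : Measure α} {T : α → α} {f : α → ℝ}

theorem integrable_maxBirkhoffSum (hT : MeasurePreserving T μ μ) (hf : Integrable f μ) (N : ℕ) :
    Integrable (maxBirkhoffSum T f N) μ := by
  induction N with
  | zero => exact integrable_zero α ℝ μ
  | succ N ih =>
    exact (integrable_zero α ℝ μ).sup (hf.add (hT.integrable_comp_of_integrable ih))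

/-- The maximal ergodic lemma. -/
theorem integral_nonneg_of_ae_exists_birkhoffSum_pos (hT : MeasurePreserving T μ μ)
    (hf : Integrable f μ) (h : ∀ᵐ x ∂μ, ∃ n, 0 < birkhoffSum T f n x) : 0 ≤ ∫ x, f x ∂μ := by
  have hmono : ∀ x, Monotone fun N => maxBirkhoffSum T f N x := fun x =>
    monotone_nat_of_le_succ fun N => maxBirkhoffSum_le_succ T f N x
  let F : ℕ → α → ℝ := fun N => {x | 0 < maxBirkhoffSum T f (N + 1) x}.indicator f
  have hnull : ∀ N, NullMeasurableSet {x | 0 < maxBirkhoffSum T f (N + 1) x} μ := fun N =>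
    nullMeasurableSet_lt aemeasurable_const (integrable_maxBirkhoffSum hT hf (N + 1)).1.aemeasurable
  have hF : ∀ N, 0 ≤ ∫ x, F N x ∂μ := by
    intro N
    have hM := integrable_maxBirkhoffSum hT hf N
    have hMT : Integrable (fun x => maxBirkhoffSum T f N (T x)) μ :=
      hT.integrable_comp_of_integrable hM
    have h0 : ∫ x, (maxBirkhoffSum T f N x - maxBirkhoffSum T f N (T x)) ∂μ = 0 := by
      rw [integral_sub hM hMT, sub_eq_zero]
      have := integral_map (μ := μ) hT.aemeasurable (f := maxBirkhoffSum T f N)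
        (by rw [hT.map_eq]; exact hM.1)
      rw [hT.map_eq] at this
      exact this
    -- Where the maximum `M_{N+1}` is positive it equals `f + M_N ∘ T`, so `f ≥ M_N - M_N ∘ T`;
    -- elsewhere `M_N ≤ 0 ≤ M_N ∘ T`. The difference integrates to zero by invariance.
    rw [← h0]
    refine integral_mono (hM.sub hMT) (hf.indicator₀ (hnull N)) fun x => ?_
    by_cases hx : 0 < maxBirkhoffSum T f (N + 1) x
    · have h1 : maxBirkhoffSum T f (N + 1) x = f x + maxBirkhoffSum T f N (T x) := by
        rcases max_choice 0 (f x + maxBirkhoffSum T f N (T x)) with h2 | h2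
        · exact absurd hx (by simp only [maxBirkhoffSum, h2]; exact lt_irrefl _)
        · exact h2
      have h2 := maxBirkhoffSum_le_succ T f N x
      simp only [F, Set.indicator, Set.mem_ofPred_eq, hx, if_true]
      linarith
    · have h2 := maxBirkhoffSum_le_succ T f N x
      have h3 := maxBirkhoffSum_nonneg T f N (T x)
      simp only [F, Set.indicator, Set.mem_ofPred_eq, hx, if_false]
      linarith
  refine ge_of_tendsto' (f := fun N => ∫ x, F N x ∂μ) (x := atTop) ?_ hF
  refine tendsto_integral_of_dominated_convergence (fun x => ‖f x‖)
    (fun N => (hf.indicator₀ (hnull N)).1) hf.norm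
    (fun N => ae_of_all _ fun x => norm_indicator_le_norm_self _ _) ?_
  filter_upwards [h] with x hx
  obtain ⟨n, hn⟩ := hx
  refine tendsto_const_nhds.congr' ?_
  filter_upwards [eventually_ge_atTop n] with N hN
  have : 0 < maxBirkhoffSum T f (N + 1) x :=
    (hn.trans_le (birkhoffSum_le_maxBirkhoffSum T f n x)).trans_le (hmono x (by omega))
  simp [F, this]

theorem measurable_birkhoffSum (hT : Measurable T) (hf : Measurable f) (n : ℕ) :
    Measurable (birkhoffSum T f n) := by
  unfold birkhoffSum
  exact Finset.measurable_sum _ fun i _ => hf.comp (hT.iterate i)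

theorem measurableSet_unboundedSet (hT : Measurable T) (hf : Measurable f) :
    MeasurableSet (unboundedSet T f) := by
  have : unboundedSet T f = ⋂ K : ℕ, ⋃ n : ℕ, {x | (K : ℝ) < birkhoffSum T f n x} := by
    ext x; simp [unboundedSet]
  rw [this]
  exact MeasurableSet.iInter fun K => MeasurableSet.iUnion fun n =>
    measurableSet_lt measurable_const (measurable_birkhoffSum hT hf n)

/-- The restriction of `μ` to an invariant set is again invariant, and unbounded Birkhoff sums are
in particular positive at some time, so the maximal ergodic lemma applies on the set. -/
theorem setIntegral_unboundedSet_nonneg (hT : MeasurePreserving T μ μ) (hfm : Measurable f)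
    (hf : Integrable f μ) : 0 ≤ ∫ x in unboundedSet T f, f x ∂μ := by
  have hA := measurableSet_unboundedSet hT.measurable hfm
  have hTA := hT.restrict_preimage hA
  rw [preimage_unboundedSet] at hTA
  refine integral_nonneg_of_ae_exists_birkhoffSum_pos hTA hf.restrict ?_
  filter_upwards [ae_restrict_mem hA] with x hx
  simpa using hx 0

/-- Monotonicity reduces the uncountable family to the values `1 / (n + 1)`. -/
theorem ae_forall_pos_of_forall_pos {p : ℝ → α → Prop}
    (hmono : ∀ x a b, 0 < a → a ≤ b → p a x → p b x) (h : ∀ a, 0 < a → ∀ᵐ x ∂μ, p a x) :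
    ∀ᵐ x ∂μ, ∀ a, 0 < a → p a x := by
  have : ∀ᵐ x ∂μ, ∀ n : ℕ, p (1 / ((n : ℝ) + 1)) x :=
    ae_all_iff.2 fun n => h _ Nat.one_div_pos_of_nat
  filter_upwards [this] with x hx a ha
  obtain ⟨n, hn⟩ := exists_nat_one_div_lt ha
  exact hmono x _ _ Nat.one_div_pos_of_nat hn.le (hx n)

/-- After subtracting the mean plus `ε` the integral is `-ε < 0`. The set of unbounded Birkhoff sums
has measure zero or one by ergodicity, and measure one would make this integral nonnegative. -/
theorem ae_birkhoffSum_le [IsProbabilityMeasure μ] (hT : Ergodic T μ) (hfm : Measurable f)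
    (hf : Integrable f μ) : ∀ᵐ x ∂μ, ∀ ε : ℝ, 0 < ε → ∃ C : ℝ, ∀ n : ℕ,
      birkhoffSum T f n x ≤ (∫ y, f y ∂μ + ε) * n + C := by
  refine ae_forall_pos_of_forall_pos ?_ ?_
  · rintro x a b - hab ⟨C, hC⟩
    refine ⟨C, fun n => (hC n).trans ?_⟩
    gcongr
  intro ε hε
  set g : α → ℝ := fun y => f y - (∫ y, f y ∂μ + ε)
  have hgm : Measurable g := hfm.sub_const _
  have hg : Integrable g μ := hf.sub (integrable_const _)
  have hgi : ∫ y, g y ∂μ = -ε := by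
    simp only [g]
    rw [integral_sub hf (integrable_const _)]
    simp
  have hA := measurableSet_unboundedSet hT.measurable hgm
  rcases hT.toPreErgodic.ae_mem_or_ae_notMem hA (preimage_unboundedSet T g) with h | h
  · have h0 := setIntegral_unboundedSet_nonneg hT.toMeasurePreserving hgm hg
    rw [Measure.restrict_eq_self_of_ae_mem h, hgi] at h0
    linarith
  · filter_upwards [h] with x hx
    simp only [unboundedSet, Set.mem_ofPred_eq, not_forall, not_exists, not_lt] at hx
    obtain ⟨K, hK⟩ := hx
    refine ⟨K, fun n => ?_⟩
    have := hK n
    simp only [g, birkhoffSum_sub_const] at this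
    linarith

/-- Birkhoff's ergodic theorem for an ergodic map. -/
theorem ae_abs_birkhoffSum_sub_le [IsProbabilityMeasure μ] (hT : Ergodic T μ) (hfm : Measurable f)
    (hf : Integrable f μ) : ∀ᵐ x ∂μ, ∀ ε : ℝ, 0 < ε → ∃ C : ℝ, ∀ n : ℕ,
      |birkhoffSum T f n x - (∫ y, f y ∂μ) * n| ≤ ε * n + C := by
  filter_upwards [ae_birkhoffSum_le hT hfm hf, ae_birkhoffSum_le hT hfm.neg hf.neg] with x h1 h2 ε hε
  obtain ⟨C1, hC1⟩ := h1 ε hε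
  obtain ⟨C2, hC2⟩ := h2 ε hε
  refine ⟨max C1 C2, fun n => abs_le.2 ⟨?_, ?_⟩⟩
  · have h3 := hC2 n
    have h4 : birkhoffSum T (-f) n x = - birkhoffSum T f n x := birkhoffSum_neg T f n x
    have h5 : ∫ y, (-f) y ∂μ = -∫ y, f y ∂μ := integral_neg f
    rw [h4, h5] at h3
    linarith [le_max_right C1 C2]
  · linarith [hC1 n, le_max_left C1 C2]

/-- If the Birkhoff averages are asymptotically at most the mean `v`, then they are asymptotically
at least `v`. -/
theorem ae_le_birkhoffSum_of_ae_birkhoffSum_le [IsFiniteMeasure μ] (hT : MeasurePreserving T μ μ)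
    (hfm : Measurable f) (hf : Integrable f μ) {v : ℝ} (hv : v * μ.real Set.univ ≤ ∫ x, f x ∂μ)
    (h : ∀ᵐ x ∂μ, ∀ ε : ℝ, 0 < ε → ∃ C : ℝ, ∀ n : ℕ, birkhoffSum T f n x ≤ (v + ε) * n + C) :
    ∀ᵐ x ∂μ, ∀ ε : ℝ, 0 < ε → ∃ C : ℝ, ∀ n : ℕ, (v - ε) * n - C ≤ birkhoffSum T f n x := by
  refine ae_forall_pos_of_forall_pos ?_ ?_
  · rintro x a b - hab ⟨C, hC⟩
    refine ⟨C, fun n => le_trans ?_ (hC n)⟩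
    gcongr
  intro ε hε
  set g : α → ℝ := fun y => (v - ε) - f y
  have hgm : Measurable g := measurable_const.sub hfm
  have hg : Integrable g μ := (integrable_const _).sub hf
  set A := unboundedSet T g with hAdef
  have hA : MeasurableSet A := measurableSet_unboundedSet hT.measurable hgm
  have hAinv : T ⁻¹' A = A := preimage_unboundedSet T g
  have h1 : 0 ≤ ∫ x in A, g x ∂μ := setIntegral_unboundedSet_nonneg hT hgm hg
  have h1' : ∫ x in A, g x ∂μ = (v - ε) * μ.real A - ∫ x in A, f x ∂μ := by
    simp only [g]
    rw [integral_sub (integrable_const _) hf.restrict]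
    simp [mul_comm]
  have hTA := hT.restrict_preimage hA.compl
  rw [Set.preimage_compl, hAinv] at hTA
  -- The Birkhoff sums of `v + δ - f` are at least `n δ / 2 - C`, hence eventually positive, so the
  -- maximal ergodic lemma applies on `Aᶜ`.
  have h2 : ∀ δ : ℝ, 0 < δ → ∫ x in Aᶜ, f x ∂μ ≤ (v + δ) * μ.real Aᶜ := by
    intro δ hδ
    have : 0 ≤ ∫ x in Aᶜ, ((v + δ) - f x) ∂μ := by
      refine integral_nonneg_of_ae_exists_birkhoffSum_pos hTA
        ((integrable_const _).sub hf.restrict) (ae_restrict_of_ae ?_)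
      filter_upwards [h] with x hx
      obtain ⟨C, hC⟩ := hx (δ / 2) (half_pos hδ)
      obtain ⟨n, hn⟩ := exists_nat_gt (C / (δ / 2))
      rw [div_lt_iff₀ (half_pos hδ)] at hn
      refine ⟨n, ?_⟩
      rw [birkhoffSum_const_sub]
      nlinarith [hC n]
    rw [integral_sub (integrable_const _) hf.restrict] at this
    simp at this
    linarith
  have h3 : ∫ x in Aᶜ, f x ∂μ ≤ v * μ.real Aᶜ := by
    refine le_of_forall_pos_le_add fun η hη => ?_
    have hpos : 0 < μ.real Aᶜ + 1 := by positivity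
    refine (h2 (η / (μ.real Aᶜ + 1)) (by positivity)).trans ?_
    rw [add_mul]
    have : η / (μ.real Aᶜ + 1) * μ.real Aᶜ ≤ η := by
      rw [div_mul_eq_mul_div, div_le_iff₀ hpos]
      nlinarith
    linarith
  have h4 := integral_add_compl hA hf
  have h5 : μ.real A + μ.real Aᶜ = μ.real Set.univ := measureReal_add_measureReal_compl hA
  -- On `A` the integral of `f` is at most `(v - ε) μ(A)`, on `Aᶜ` at most `v μ(Aᶜ)`. The total is
  -- at least `v` times the full mass, which leaves no room for mass in `A`.
  have h6 : μ.real A = 0 := by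
    refine le_antisymm ?_ measureReal_nonneg
    rw [← h5] at hv
    by_contra hc
    push Not at hc
    nlinarith
  have h7 : μ A = 0 := by
    rwa [measureReal_eq_zero_iff] at h6
  filter_upwards [measure_eq_zero_iff_ae_notMem.1 h7] with x hx
  simp only [hAdef, unboundedSet, Set.mem_ofPred_eq, not_forall, not_exists, not_lt] at hx
  obtain ⟨K, hK⟩ := hx
  refine ⟨K, fun n => ?_⟩
  have := hK n
  simp only [g, birkhoffSum_const_sub] at this
  linarith

end ErgodicTheory

/-! ### The quenched law: cylinder probabilities, Markov property, first-step decomposition. -/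

section QuenchedWalk

variable (u : ℝ → ℝ → ℝ) (lam : ℝ) (ρ : ℕ) (ω : Env)

instance isProbabilityMeasure_walkLaw (i : ℤ) : IsProbabilityMeasure (walkLaw u lam ρ ω i) := by
  unfold walkLaw
  infer_instance

theorem stepPMF_apply (i j : ℤ) :
    stepPMF u lam ρ ω i j = ENNReal.ofReal (jumpProb u lam ρ ω i j) := rfl

/-- The Markov property. -/
theorem lintegral_walkLaw_succ (i : ℤ) (n : ℕ) (F : (Finset.Iic n → ℤ) → ℤ → ℝ≥0∞) :
    ∫⁻ X, F (Preorder.frestrictLe n X) (X (n + 1)) ∂walkLaw u lam ρ ω i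
      = ∫⁻ X, ∑' j, F (Preorder.frestrictLe n X) j * stepPMF u lam ρ ω (X n) j
          ∂walkLaw u lam ρ ω i := by
  have hF : Measurable fun z : (Finset.Iic n → ℤ) × ℤ => F z.1 z.2 := Measurable.of_discrete
  have h1 := Kernel.partialTraj_compProd_eq_map_traj (X := fun _ => ℤ)
    (κ := stepKernel u lam ρ ω) (zero_le : 0 ≤ n) (x₀ := fun _ => i)
  have h2 := Kernel.traj_map_frestrictLe_apply (X := fun _ => ℤ) (κ := stepKernel u lam ρ ω) 0 n
    (fun _ => i)
  have hm : Measurable fun X : ℕ → ℤ => (Preorder.frestrictLe (π := fun _ => ℤ) n X, X (n + 1)) := by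
    fun_prop
  have h3 := lintegral_map (μ := walkLaw u lam ρ ω i) hF hm
  rw [← h3, walkLaw, ← h1, Measure.lintegral_compProd hF, ← h2,
    lintegral_map Measurable.of_discrete (by fun_prop)]
  refine lintegral_congr fun X => ?_
  rw [lintegral_countable']
  refine tsum_congr fun j => ?_
  congr 1
  exact PMF.toMeasure_apply_singleton _ _ (measurableSet_singleton j)

theorem ae_walkLaw_zero (i : ℤ) : ∀ᵐ X ∂walkLaw u lam ρ ω i, X 0 = i := by
  have h2 := Kernel.traj_map_frestrictLe_apply (X := fun _ => ℤ) (κ := stepKernel u lam ρ ω) 0 0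
    (fun _ => i)
  rw [Kernel.partialTraj_self, Kernel.id_apply] at h2
  have hm : Measurable (Preorder.frestrictLe (π := fun _ : ℕ => ℤ) 0) := by fun_prop
  have h3 : ∀ᵐ h ∂(walkLaw u lam ρ ω i).map (Preorder.frestrictLe (π := fun _ : ℕ => ℤ) 0),
      h ⟨0, Finset.mem_Iic.2 le_rfl⟩ = i := by
    rw [walkLaw, h2, ae_dirac_iff (MeasurableSet.of_discrete)]
  exact ae_of_ae_map hm.aemeasurable h3

/-- The trajectories that follow `y` up to time `n`. -/
def pathCylinder (n : ℕ) (y : ℕ → ℤ) : Set (ℕ → ℤ) := {X | ∀ k ≤ n, X k = y k}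

theorem measurableSet_coord_eq (k : ℕ) (z : ℤ) : MeasurableSet {X : ℕ → ℤ | X k = z} :=
  measurableSet_eq_fun (measurable_pi_apply k) measurable_const

theorem measurableSet_pathCylinder (n : ℕ) (y : ℕ → ℤ) : MeasurableSet (pathCylinder n y) := by
  have : pathCylinder n y = ⋂ k, ⋂ (_ : k ≤ n), {X : ℕ → ℤ | X k = y k} := by
    ext X; simp [pathCylinder]
  rw [this]
  exact MeasurableSet.iInter fun k => MeasurableSet.iInter fun _ =>
    measurableSet_coord_eq k (y k)

/-- As `ℤ` is countable, the law of the first `n + 1` coordinates is determined by its values on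
single paths, and these finite-dimensional laws determine the measure. -/
theorem measure_ext_of_pathCylinder {μ ν : Measure (ℕ → ℤ)} [IsFiniteMeasure μ]
    (h : ∀ n y, μ (pathCylinder n y) = ν (pathCylinder n y)) : μ = ν := by
  have hm : ∀ n, Measurable (Preorder.frestrictLe (π := fun _ : ℕ => ℤ) n) := fun n => by fun_prop
  have key : ∀ n, μ.map (Preorder.frestrictLe (π := fun _ : ℕ => ℤ) n)
      = ν.map (Preorder.frestrictLe (π := fun _ : ℕ => ℤ) n) := by
    intro n
    refine Measure.ext_of_singleton fun z => ?_
    rw [Measure.map_apply (hm n) (measurableSet_singleton z),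
      Measure.map_apply (hm n) (measurableSet_singleton z)]
    let y : ℕ → ℤ := fun k => if hk : k ≤ n then z ⟨k, Finset.mem_Iic.2 hk⟩ else 0
    have : Preorder.frestrictLe (π := fun _ : ℕ => ℤ) n ⁻¹' {z} = pathCylinder n y := by
      ext X
      simp only [Set.mem_preimage, Set.mem_singleton_iff, pathCylinder, Set.mem_ofPred_eq,
        funext_iff, Subtype.forall, Finset.mem_Iic, Preorder.frestrictLe_apply]
      refine forall_congr' fun k => forall_congr' fun hk => ?_
      simp [y, hk]
    rw [this, h]
  refine ext_of_generate_finite _ generateFrom_measurableCylinders.symm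
    isPiSystem_measurableCylinders (fun s hs => ?_) ?_
  · rw [measurableCylinders_nat] at hs
    simp only [Set.mem_iUnion, Set.mem_singleton_iff] at hs
    obtain ⟨n, S, hS, rfl⟩ := hs
    have := congrArg (fun m => m S) (key n)
    simp only [Measure.map_apply (hm n) hS] at this
    exact this
  · have := congrArg (fun m => m Set.univ) (key 0)
    simp only [Measure.map_apply (hm 0) MeasurableSet.univ] at this
    exact this

theorem walkLaw_pathCylinder (i : ℤ) (n : ℕ) (y : ℕ → ℤ) :
    walkLaw u lam ρ ω i (pathCylinder n y)
      = if y 0 = i then ∏ k ∈ Finset.range n, stepPMF u lam ρ ω (y k) (y (k + 1)) else 0 := by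
  induction n with
  | zero =>
    simp only [Finset.range_zero, Finset.prod_empty]
    split_ifs with h
    · rw [← prob_compl_eq_zero_iff (measurableSet_pathCylinder 0 y)]
      refine measure_mono_null ?_ (ae_walkLaw_zero u lam ρ ω i)
      intro X hX hX'
      exact hX fun k hk => by
        obtain rfl : k = 0 := by omega
        exact hX'.trans h.symm
    · refine measure_mono_null ?_ (ae_walkLaw_zero u lam ρ ω i)
      intro X hX hX'
      exact h ((hX 0 le_rfl).symm.trans hX')
  | succ n ih =>
    classical
    -- Applied to this indicator of the path `y`, the Markov property is the recursion for cylinder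
    -- probabilities.
    let F : (Finset.Iic n → ℤ) → ℤ → ℝ≥0∞ := fun z j =>
      if (∀ k : Finset.Iic n, z k = y k) ∧ j = y (n + 1) then 1 else 0
    have h1 := lintegral_walkLaw_succ u lam ρ ω i n F
    have h2 : ∀ X : ℕ → ℤ, F (Preorder.frestrictLe n X) (X (n + 1))
        = (pathCylinder (n + 1) y).indicator 1 X := by
      intro X
      have : (∀ k : Finset.Iic n, Preorder.frestrictLe (π := fun _ : ℕ => ℤ) n X k = y k)
          ∧ X (n + 1) = y (n + 1) ↔ X ∈ pathCylinder (n + 1) y := by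
        simp only [pathCylinder, Set.mem_ofPred_eq, Subtype.forall, Finset.mem_Iic,
          Preorder.frestrictLe_apply]
        exact ⟨fun h k hk => (Nat.le_succ_iff.1 hk).elim (h.1 k) (fun e => e ▸ h.2),
          fun h => ⟨fun k hk => h k (by omega), h _ le_rfl⟩⟩
      simp only [F, this, Set.indicator, Pi.one_apply]
    have h3 : ∀ X : ℕ → ℤ, ∑' j, F (Preorder.frestrictLe n X) j * stepPMF u lam ρ ω (X n) j
        = (pathCylinder n y).indicator
            (fun _ => stepPMF u lam ρ ω (y n) (y (n + 1))) X := by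
      intro X
      have : (∀ k : Finset.Iic n, Preorder.frestrictLe (π := fun _ : ℕ => ℤ) n X k = y k)
          ↔ X ∈ pathCylinder n y := by
        simp [pathCylinder]
      rw [tsum_eq_single (y (n + 1)) (by
        intro j hj
        simp [F, hj])]
      by_cases hX : X ∈ pathCylinder n y
      · have hXn : X n = y n := hX n le_rfl
        simp only [F, this, hX, hXn, Set.indicator, and_self, if_true, one_mul]
      · simp only [F, this, hX, Set.indicator, false_and, if_false, zero_mul]
    simp_rw [h2, h3] at h1
    rw [lintegral_indicator_one (measurableSet_pathCylinder _ _),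
      lintegral_indicator_const (measurableSet_pathCylinder _ _), ih] at h1
    rw [h1, Finset.prod_range_succ, mul_comm]
    split_ifs <;> simp

theorem walkLaw_shift {l : ℤ}
    (hstep : ∀ i j, stepPMF u lam ρ (shift l ω) i j = stepPMF u lam ρ ω (i + l) (j + l)) (i : ℤ) :
    (walkLaw u lam ρ ω (i + l)).map (fun X k => X k - l) = walkLaw u lam ρ (shift l ω) i := by
  have hm : Measurable fun (X : ℕ → ℤ) (k : ℕ) => X k - l :=
    measurable_pi_lambda _ fun k =>
      (Measurable.of_discrete (f := fun z : ℤ => z - l)).comp (measurable_pi_apply k)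
  have := Measure.isProbabilityMeasure_map (μ := walkLaw u lam ρ ω (i + l)) hm.aemeasurable
  refine measure_ext_of_pathCylinder fun n y => ?_
  rw [Measure.map_apply hm (measurableSet_pathCylinder n y), walkLaw_pathCylinder]
  have : (fun (X : ℕ → ℤ) (k : ℕ) => X k - l) ⁻¹' pathCylinder n y
      = pathCylinder n fun k => y k + l := by
    ext X
    simp [pathCylinder, sub_eq_iff_eq_add]
  rw [this, walkLaw_pathCylinder]
  simp [hstep]

/-- On path cylinders: prepending `i` to a path that starts at `j` multiplies its probability by the
first jump probability; paths that do not start at `j` have mass zero on both sides. -/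
theorem walkLaw_restrict_first_step (i j : ℤ) :
    ((walkLaw u lam ρ ω i).restrict {X | X 1 = j}).map (fun X k => X (k + 1))
      = stepPMF u lam ρ ω i j • walkLaw u lam ρ ω j := by
  have hm : Measurable fun (X : ℕ → ℤ) (k : ℕ) => X (k + 1) :=
    measurable_pi_lambda _ fun k => measurable_pi_apply (k + 1)
  refine measure_ext_of_pathCylinder fun n y => ?_
  rw [Measure.map_apply hm (measurableSet_pathCylinder n y), Measure.smul_apply,
    walkLaw_pathCylinder, Measure.restrict_apply (hm (measurableSet_pathCylinder n y))]
  by_cases hy : y 0 = j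
  · have h1 : walkLaw u lam ρ ω i ((fun (X : ℕ → ℤ) (k : ℕ) => X (k + 1)) ⁻¹' pathCylinder n y
        ∩ {X | X 1 = j}) = walkLaw u lam ρ ω i (pathCylinder (n + 1) fun k =>
          if k = 0 then i else y (k - 1)) := by
      refine measure_congr ?_
      filter_upwards [ae_walkLaw_zero u lam ρ ω i] with X hX
      refine propext ⟨fun h k hk => ?_, fun h => ⟨fun k hk => ?_, ?_⟩⟩
      · rcases k with _ | k
        · simpa using hX
        · simpa using h.1 k (by omega)
      · simpa using h (k + 1) (by omega)
      · have := h 1 (by omega)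
        simp only [one_ne_zero, if_false, Nat.sub_self] at this
        exact this.trans hy
    rw [h1, walkLaw_pathCylinder, Finset.prod_range_succ']
    simp [hy, mul_comm]
  · rw [if_neg hy, smul_zero]
    refine measure_mono_null (t := ∅) ?_ (measure_empty)
    rintro X ⟨h1, h2⟩
    exact hy ((h1 0 (Nat.zero_le n)).symm.trans h2)

/-- The first-step decomposition, seen from the walker. -/
theorem lintegral_walkLaw_first_step
    (hstep : ∀ l i j, stepPMF u lam ρ (shift l ω) i j = stepPMF u lam ρ ω (i + l) (j + l))
    {f : ℤ → (ℕ → ℤ) → ℝ≥0∞} (hf : ∀ j, Measurable (f j)) :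
    ∫⁻ X, f (X 1) (fun k => X (k + 1) - X 1) ∂walkLaw u lam ρ ω 0
      = ∑' j, stepPMF u lam ρ ω 0 j * ∫⁻ Y, f j Y ∂walkLaw u lam ρ (shift j ω) 0 := by
  have hdisj : Pairwise (Function.onFun Disjoint fun j : ℤ => {X : ℕ → ℤ | X 1 = j}) := by
    intro a b hab
    refine Set.disjoint_left.2 fun X hX hX' => hab ?_
    exact (show X 1 = a from hX).symm.trans hX'
  have hmeas : ∀ j : ℤ, MeasurableSet {X : ℕ → ℤ | X 1 = j} := fun j =>
    measurableSet_coord_eq 1 j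
  have hun : ⋃ j : ℤ, {X : ℕ → ℤ | X 1 = j} = Set.univ := by ext X; simp
  rw [← setLIntegral_univ, ← hun, lintegral_iUnion hmeas hdisj]
  refine tsum_congr fun j => ?_
  have hm : Measurable fun (X : ℕ → ℤ) (k : ℕ) => X (k + 1) :=
    measurable_pi_lambda _ fun k => measurable_pi_apply (k + 1)
  have hs : Measurable fun (X : ℕ → ℤ) (k : ℕ) => X k - j :=
    measurable_pi_lambda _ fun k =>
      (Measurable.of_discrete (f := fun z : ℤ => z - j)).comp (measurable_pi_apply k)
  have h1 : ∫⁻ X in {X : ℕ → ℤ | X 1 = j}, f (X 1) (fun k => X (k + 1) - X 1) ∂walkLaw u lam ρ ω 0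
      = ∫⁻ X in {X : ℕ → ℤ | X 1 = j}, f j (fun k => X (k + 1) - j) ∂walkLaw u lam ρ ω 0 := by
    refine setLIntegral_congr_fun (hmeas j) fun X hX => ?_
    simp only [show X 1 = j from hX]
  have h2 := lintegral_map (μ := (walkLaw u lam ρ ω 0).restrict {X | X 1 = j})
    ((hf j).comp hs) hm
  have h3 := walkLaw_shift u lam ρ ω (hstep j) 0
  rw [zero_add] at h3
  rw [h1, ← h3, lintegral_map (hf j) hs]
  refine h2.symm.trans ?_
  rw [walkLaw_restrict_first_step, lintegral_smul_measure]
  rfl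

/-- Iterates a Lyapunov inequality; it is used below with `h` an exponential function. -/
theorem lintegral_walkLaw_le {h : ℤ → ℝ≥0∞} {c : ℝ≥0∞}
    (hc : ∀ k, ∑' j, h j * stepPMF u lam ρ ω k j ≤ c * h k) (i : ℤ) (n : ℕ) :
    ∫⁻ X, h (X n) ∂walkLaw u lam ρ ω i ≤ c ^ n * h i := by
  induction n with
  | zero =>
    rw [lintegral_congr_ae (g := fun _ => h i) (by
      filter_upwards [ae_walkLaw_zero u lam ρ ω i] with X hX
      rw [hX])]
    simp
  | succ n ih =>
    rw [lintegral_walkLaw_succ u lam ρ ω i n fun _ j => h j]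
    calc ∫⁻ X, ∑' j, h j * stepPMF u lam ρ ω (X n) j ∂walkLaw u lam ρ ω i
        ≤ ∫⁻ X, c * h (X n) ∂walkLaw u lam ρ ω i := lintegral_mono fun X => hc (X n)
      _ = c * ∫⁻ X, h (X n) ∂walkLaw u lam ρ ω i :=
        lintegral_const_mul _ (Measurable.of_discrete.comp (measurable_pi_apply n))
      _ ≤ c * (c ^ n * h i) := by gcongr
      _ = c ^ (n + 1) * h i := by ring

end QuenchedWalk

/-! ### Covariance of the model under shifts of the environment. -/

section Shift

theorem gap_shift (l : ℤ) (ω : Env) (k : ℤ) : gap (shift l ω) k = gap ω (k + l) := rfl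

theorem mark_shift (l : ℤ) (ω : Env) (k : ℤ) : mark (shift l ω) k = mark ω (k + l) := rfl

theorem shift_shift (a b : ℤ) (ω : Env) : shift a (shift b ω) = shift (a + b) ω := by
  funext k
  simp [shift, add_assoc]

theorem shift_zero (ω : Env) : shift 0 ω = ω := by
  funext k
  simp [shift]

theorem pos_shift (l : ℤ) (ω : Env) (k : ℤ) : pos (shift l ω) k = pos ω (k + l) - pos ω l := by
  induction k using Int.induction_on with
  | zero => simp [pos_zero]
  | succ k ih =>
    rw [pos_succ, ih, gap_shift, show (k : ℤ) + 1 + l = (k + l) + 1 by ring, pos_succ]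
    ring
  | pred k ih =>
    have h1 := pos_succ (shift l ω) (-(k : ℤ) - 1)
    have h2 := pos_succ ω (-(k : ℤ) - 1 + l)
    rw [gap_shift] at h1
    rw [sub_add_cancel] at h1
    rw [show -(k : ℤ) - 1 + l + 1 = -k + l by ring] at h2
    linarith

/-- Only the bias sees the choice of origin. The common factor cancels in the jump probabilities,
which are therefore exactly covariant. -/
theorem conductance_shift (u : ℝ → ℝ → ℝ) (lam : ℝ) (l : ℤ) (ω : Env) (i j : ℤ) :
    conductance u lam (shift l ω) i j
      = Real.exp (-(2 * lam * pos ω l)) * conductance u lam ω (i + l) (j + l) := by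
  unfold conductance
  by_cases h : i = j
  · simp [h]
  · have h' : i + l ≠ j + l := by simpa using h
    rw [if_neg h, if_neg h', ← Real.exp_add, pos_shift, pos_shift, mark_shift, mark_shift]
    congr 1
    rw [show pos ω (j + l) - pos ω l - (pos ω (i + l) - pos ω l)
      = pos ω (j + l) - pos ω (i + l) by ring]
    ring

/-- The total conductance at the site `i`. -/
noncomputable def totalConductance (u : ℝ → ℝ → ℝ) (lam : ℝ) (ω : Env) (i : ℤ) : ℝ :=
  ∑' k : ℤ, conductance u lam ω i k

theorem totalConductance_shift (u : ℝ → ℝ → ℝ) (lam : ℝ) (l : ℤ) (ω : Env) (i : ℤ) :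
    totalConductance u lam (shift l ω) i
      = Real.exp (-(2 * lam * pos ω l)) * totalConductance u lam ω (i + l) := by
  unfold totalConductance
  simp_rw [conductance_shift, tsum_mul_left]
  congr 1
  exact (Equiv.addRight l).tsum_eq fun k => conductance u lam ω (i + l) k

theorem fullJumpProb_eq (u : ℝ → ℝ → ℝ) (lam : ℝ) (ω : Env) (i j : ℤ) :
    fullJumpProb u lam ω i j = conductance u lam ω i j / totalConductance u lam ω i := rfl

theorem fullJumpProb_shift (u : ℝ → ℝ → ℝ) (lam : ℝ) (l : ℤ) (ω : Env) (i j : ℤ) :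
    fullJumpProb u lam (shift l ω) i j = fullJumpProb u lam ω (i + l) (j + l) := by
  rw [fullJumpProb_eq, fullJumpProb_eq, conductance_shift, totalConductance_shift,
    mul_div_mul_left _ _ (Real.exp_pos _).ne']

theorem jumpProb_shift (u : ℝ → ℝ → ℝ) (lam : ℝ) (ρ : ℕ) (l : ℤ) (ω : Env) (i j : ℤ) :
    jumpProb u lam ρ (shift l ω) i j = jumpProb u lam ρ ω (i + l) (j + l) := by
  unfold jumpProb
  simp only [fullJumpProb_shift, add_left_inj, add_sub_add_right_eq_sub]
  congr 2
  have : (Finset.Icc (i - (ρ : ℤ)) (i + ρ)).map (addRightEmbedding l)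
      = Finset.Icc (i + l - (ρ : ℤ)) (i + l + ρ) := by
    rw [Finset.map_add_right_Icc]
    congr 1 <;> ring
  rw [← this, Finset.sum_map]
  rfl

theorem stepPMF_shift (u : ℝ → ℝ → ℝ) (lam : ℝ) (ρ : ℕ) (ω : Env) (l i j : ℤ) :
    stepPMF u lam ρ (shift l ω) i j = stepPMF u lam ρ ω (i + l) (j + l) := by
  rw [stepPMF_apply, stepPMF_apply, jumpProb_shift]

theorem measurable_shift (l : ℤ) : Measurable (shift l) :=
  measurable_pi_lambda _ fun k => measurable_pi_apply (k + l)

/-- The shift by one as a measurable equivalence. -/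
def shiftEquiv : Env ≃ᵐ Env where
  toFun := shift 1
  invFun := shift (-1)
  left_inv ω := by rw [shift_shift, neg_add_cancel, shift_zero]
  right_inv ω := by rw [shift_shift, add_neg_cancel, shift_zero]
  measurable_toFun := measurable_shift 1
  measurable_invFun := measurable_shift (-1)

theorem iterate_shift (l : ℤ) (n : ℕ) : (shift l)^[n] = shift (n * l) := by
  induction n with
  | zero => funext ω; simp [shift_zero]
  | succ n ih =>
    funext ω
    rw [Function.iterate_succ_apply', ih, shift_shift]
    congr 1
    push_cast
    ring

variable {P : Measure Env}

theorem IsEnvLaw.ergodic_neg (hP : IsEnvLaw P) : Ergodic (shift (-1)) P :=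
  Ergodic.symm (e := shiftEquiv) hP.ergodic

theorem IsEnvLaw.measurePreserving_shift (hP : IsEnvLaw P) (l : ℤ) :
    MeasurePreserving (shift l) P P := by
  obtain ⟨n, rfl | rfl⟩ := l.eq_nat_or_neg
  · have := hP.ergodic.toMeasurePreserving.iterate n
    rwa [iterate_shift, mul_one] at this
  · have := hP.ergodic_neg.toMeasurePreserving.iterate n
    rwa [iterate_shift, mul_neg_one] at this

theorem IsEnvLaw.lintegral_shift (hP : IsEnvLaw P) (l : ℤ) {f : Env → ℝ≥0∞} (hf : Measurable f) :
    ∫⁻ ω, f (shift l ω) ∂P = ∫⁻ ω, f ω ∂P :=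
  (hP.measurePreserving_shift l).lintegral_comp hf

theorem IsEnvLaw.ae_shift (hP : IsEnvLaw P) {p : Env → Prop} (h : ∀ᵐ ω ∂P, p ω) :
    ∀ᵐ ω ∂P, ∀ l, p (shift l ω) :=
  ae_all_iff.2 fun l => (hP.measurePreserving_shift l).quasiMeasurePreserving.ae h

end Shift

/-! ### Measurability in the environment. -/

section Measurability

theorem measurable_gap (k : ℤ) : Measurable fun ω : Env => gap ω k :=
  measurable_subtype_coe.comp (measurable_fst.comp (measurable_pi_apply k))

theorem measurable_mark (k : ℤ) : Measurable fun ω : Env => mark ω k :=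
  measurable_snd.comp (measurable_pi_apply k)

theorem measurable_pos (k : ℤ) : Measurable fun ω : Env => pos ω k :=
  (Finset.measurable_sum _ fun j _ => measurable_gap j).sub
    (Finset.measurable_sum _ fun j _ => measurable_gap j)

variable {u : ℝ → ℝ → ℝ} (hu : Measurable (Function.uncurry u)) (lam : ℝ)
include hu

theorem measurable_conductance (i j : ℤ) : Measurable fun ω : Env => conductance u lam ω i j := by
  unfold conductance
  split_ifs
  · exact measurable_const
  · have h1 : Measurable fun ω : Env => u (mark ω i) (mark ω j) :=
      hu.comp ((measurable_mark i).prodMk (measurable_mark j))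
    have h2 := measurable_pos i
    have h3 := measurable_pos j
    exact ((((h2.add h3).const_mul lam).sub (h3.sub h2).abs).add h1).exp

theorem measurable_totalConductance (i : ℤ) :
    Measurable fun ω : Env => totalConductance u lam ω i := by
  exact Measurable.tsum fun k => measurable_conductance hu lam i k

theorem measurable_fullJumpProb (i j : ℤ) : Measurable fun ω : Env => fullJumpProb u lam ω i j :=
  (measurable_conductance hu lam i j).div (measurable_totalConductance hu lam i)

theorem measurable_jumpProb (ρ : ℕ) (i j : ℤ) : Measurable fun ω : Env => jumpProb u lam ρ ω i j := by
  unfold jumpProb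
  split_ifs
  · exact measurable_const.sub
      (Finset.measurable_sum _ fun k _ => measurable_fullJumpProb hu lam i k)
  · exact measurable_fullJumpProb hu lam i j
  · exact measurable_const

theorem measurable_stepPMF (ρ : ℕ) (i j : ℤ) : Measurable fun ω : Env => stepPMF u lam ρ ω i j :=
  (measurable_jumpProb hu lam ρ i j).ennreal_ofReal

/-- A cylinder event is a countable disjoint union of path cylinders, and these have explicit
measurable probabilities. -/
theorem measurable_walkLaw (ρ : ℕ) (i : ℤ) : Measurable fun ω : Env => walkLaw u lam ρ ω i := by
  refine Measurable.measure_of_isPiSystem_of_isProbabilityMeasure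
    generateFrom_measurableCylinders.symm isPiSystem_measurableCylinders fun s hs => ?_
  rw [measurableCylinders_nat] at hs
  simp only [Set.mem_iUnion, Set.mem_singleton_iff] at hs
  obtain ⟨n, S, hS, rfl⟩ := hs
  let y : (Finset.Iic n → ℤ) → ℕ → ℤ := fun z k =>
    if hk : k ≤ n then z ⟨k, Finset.mem_Iic.2 hk⟩ else 0
  have h1 : cylinder (Finset.Iic n) S = ⋃ z : S, pathCylinder n (y z) := by
    ext X
    simp only [mem_cylinder, Set.mem_iUnion, pathCylinder, Set.mem_ofPred_eq, Subtype.exists]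
    constructor
    · intro h
      exact ⟨_, h, fun k hk => by simp [y, hk]⟩
    · rintro ⟨z, hz, h⟩
      convert hz using 1
      funext k
      have := h k (Finset.mem_Iic.1 k.2)
      simpa [y, Finset.mem_Iic.1 k.2] using this
  have h2 : Pairwise (Function.onFun Disjoint fun z : S => pathCylinder n (y z)) := by
    intro a b hab
    refine Set.disjoint_left.2 fun X hX hX' => hab (Subtype.ext (funext fun k => ?_))
    have h3 := (hX k (Finset.mem_Iic.1 k.2)).symm.trans (hX' k (Finset.mem_Iic.1 k.2))
    simpa [y, Finset.mem_Iic.1 k.2] using h3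
  simp_rw [h1, measure_iUnion h2 fun z => measurableSet_pathCylinder n (y z),
    walkLaw_pathCylinder]
  refine Measurable.tsum fun z => ?_
  split_ifs
  · exact Finset.measurable_prod _ fun k _ => measurable_stepPMF hu lam ρ _ _
  · exact measurable_const

end Measurability

/-! ### Geometric decay and summability of the conductances. -/

section Conductances

variable {u : ℝ → ℝ → ℝ} {lam : ℝ} {ω : Env}

theorem conductance_symm (hu_symm : ∀ a b : ℝ, u a b = u b a) (i j : ℤ) :
    conductance u lam ω i j = conductance u lam ω j i := by
  unfold conductance
  rw [abs_sub_comm, hu_symm, add_comm (pos ω i)]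
  simp only [eq_comm]

theorem conductance_pos {i j : ℤ} (h : i ≠ j) : 0 < conductance u lam ω i j := by
  rw [conductance, if_neg h]
  exact Real.exp_pos _

theorem mul_le_pos_sub_pos {d : ℝ} (hω : ∀ k, d ≤ gap ω k) (k : ℤ) (n : ℕ) :
    n * d ≤ pos ω (k + n) - pos ω k := by
  induction n with
  | zero => simp
  | succ n ih =>
    have := pos_succ ω (k + n)
    rw [Nat.cast_succ, Nat.cast_succ, ← add_assoc]
    have := hω (k + n)
    linarith

variable {umin umax : ℝ} (hu_bdd : ∀ a b : ℝ, umin ≤ u a b ∧ u a b ≤ umax)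
  (hlam1 : lam < 1) {d : ℝ} (hd : 0 < d) (hω : ∀ k, d ≤ gap ω k)
include hu_bdd hlam1 hd hω

/-- To the right the exponent depends on the target through `-(1 - lam)` times its position, and
each further site adds at least `d`. The factor `exp (umax - umin)` absorbs the marks. -/
theorem conductance_le_forward (i : ℤ) (n : ℕ) :
    conductance u lam ω i (i + 1 + n) ≤ Real.exp (umax - umin)
      * Real.exp (-((1 - lam) * d)) ^ n * conductance u lam ω i (i + 1) := by
  rw [conductance, conductance, if_neg (by omega), if_neg (by omega), ← Real.exp_nat_mul,
    ← Real.exp_add, ← Real.exp_add]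
  refine Real.exp_le_exp.2 ?_
  have h1 := mul_le_pos_sub_pos hω (i + 1) n
  have h2 := pos_succ ω i
  have h3 := hω i
  have h4 : 0 ≤ n * d := by positivity
  rw [abs_of_nonneg (by linarith), abs_of_nonneg (by linarith)]
  have h5 := (hu_bdd (mark ω i) (mark ω (i + 1 + n))).2
  have h6 := (hu_bdd (mark ω i) (mark ω (i + 1))).1
  have h7 := mul_le_mul_of_nonneg_left h1 (sub_nonneg.2 hlam1.le)
  linarith

variable (hlam0 : 0 ≤ lam)
include hlam0

/-- To the left the true rate is `1 + lam`; the weaker rate `1 - lam` suffices because `lam ≥ 0`,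
and it gives the same constant on both sides. -/
theorem conductance_le_backward (i : ℤ) (n : ℕ) :
    conductance u lam ω i (i - 1 - n) ≤ Real.exp (umax - umin)
      * Real.exp (-((1 - lam) * d)) ^ n * conductance u lam ω i (i - 1) := by
  rw [conductance, conductance, if_neg (by omega), if_neg (by omega), ← Real.exp_nat_mul,
    ← Real.exp_add, ← Real.exp_add]
  refine Real.exp_le_exp.2 ?_
  have h1 := mul_le_pos_sub_pos hω (i - 1 - n) n
  have h2 := pos_succ ω (i - 1)
  rw [sub_add_cancel] at h1 h2
  have h3 := hω (i - 1)
  have h4 : 0 ≤ n * d := by positivity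
  rw [abs_of_nonpos (by linarith), abs_of_nonpos (by linarith)]
  have h5 := (hu_bdd (mark ω i) (mark ω (i - 1 - n))).2
  have h6 := (hu_bdd (mark ω i) (mark ω (i - 1))).1
  have h7 := mul_le_mul_of_nonneg_left h1 (sub_nonneg.2 hlam1.le)
  have h8 : 0 ≤ lam * (pos ω (i - 1) - pos ω (i - 1 - n)) := mul_nonneg hlam0 (by linarith)
  linarith

theorem hasSum_conductance (i : ℤ) : ∃ a b : ℝ,
    HasSum (fun n : ℕ => conductance u lam ω i (i + 1 + n)) a ∧
    HasSum (fun n : ℕ => conductance u lam ω i (i - 1 - n)) b ∧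
    HasSum (fun k => conductance u lam ω i k) (a + b) ∧
    a ≤ Real.exp (umax - umin) * (1 - Real.exp (-((1 - lam) * d)))⁻¹
      * conductance u lam ω i (i + 1) ∧
    b ≤ Real.exp (umax - umin) * (1 - Real.exp (-((1 - lam) * d)))⁻¹
      * conductance u lam ω i (i - 1) := by
  have hr : Real.exp (-((1 - lam) * d)) < 1 := by
    rw [Real.exp_lt_one_iff]
    have : 0 < (1 - lam) * d := mul_pos (sub_pos.2 hlam1) hd
    linarith
  have hg := hasSum_geometric_of_lt_one (Real.exp_pos _).le hr
  have ga := (hg.mul_left (Real.exp (umax - umin))).mul_right (conductance u lam ω i (i + 1))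
  have gb := (hg.mul_left (Real.exp (umax - umin))).mul_right (conductance u lam ω i (i - 1))
  have sa : Summable fun n : ℕ => conductance u lam ω i (i + 1 + n) :=
    Summable.of_nonneg_of_le (fun n => conductance_nonneg _ _ _ _ _)
      (conductance_le_forward hu_bdd hlam1 hd hω i) ga.summable
  have sb : Summable fun n : ℕ => conductance u lam ω i (i - 1 - n) :=
    Summable.of_nonneg_of_le (fun n => conductance_nonneg _ _ _ _ _)
      (conductance_le_backward hu_bdd hlam1 hd hω hlam0 i) gb.summable
  refine ⟨_, _, sa.hasSum, sb.hasSum, ?_,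
    hasSum_le (conductance_le_forward hu_bdd hlam1 hd hω i) sa.hasSum ga,
    hasSum_le (conductance_le_backward hu_bdd hlam1 hd hω hlam0 i) sb.hasSum gb⟩
  -- The splitting of a series over `ℤ` has its nonnegative half start at the site `i` itself, where
  -- the conductance vanishes.
  have h0 : conductance u lam ω i i = 0 := by simp [conductance]
  have h1 : HasSum (fun n : ℕ => conductance u lam ω i (i + n))
      (∑' n : ℕ, conductance u lam ω i (i + 1 + n)) := by
    rw [← hasSum_nat_add_iff' 1]
    simp only [Finset.range_one, Finset.sum_singleton, Nat.cast_zero, add_zero, h0, sub_zero]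
    refine sa.hasSum.congr_fun ?_
    intro n
    push_cast
    ring_nf
  have h2 : HasSum (fun k : ℤ => conductance u lam ω i (i + k))
      (∑' n : ℕ, conductance u lam ω i (i + 1 + n)
        + ∑' n : ℕ, conductance u lam ω i (i - 1 - n)) := by
    refine HasSum.of_nat_of_neg_add_one h1 ?_
    refine sb.hasSum.congr_fun ?_
    intro n
    ring_nf
  exact (Equiv.addLeft i).hasSum_iff.1 h2

end Conductances

/-! ### The walk with jumps of length at most one, and growth bounds from drift bounds. -/

section NearestNeighbour

variable (u : ℝ → ℝ → ℝ) (lam : ℝ) (ω : Env)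

theorem jumpProb_one_of_abs_eq_one {i j : ℤ} (h : |i - j| = 1) :
    jumpProb u lam 1 ω i j = fullJumpProb u lam ω i j := by
  have h1 : i ≠ j := by
    rintro rfl
    simp at h
  simp [jumpProb, h1, h]

theorem Icc_sub_one_add_one (k : ℤ) :
    Finset.Icc (k - ((1 : ℕ) : ℤ)) (k + ((1 : ℕ) : ℤ)) = {k - 1, k, k + 1} := by
  ext j
  simp only [Finset.mem_Icc, Finset.mem_insert, Finset.mem_singleton]
  omega

theorem jumpProb_one_self (k : ℤ) :
    jumpProb u lam 1 ω k k
      = 1 - fullJumpProb u lam ω k (k + 1) - fullJumpProb u lam ω k (k - 1) := by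
  have h : fullJumpProb u lam ω k k = 0 := by simp [fullJumpProb, conductance]
  rw [jumpProb, if_pos rfl, Icc_sub_one_add_one, Finset.sum_insert (by simp; omega),
    Finset.sum_insert (by simp), Finset.sum_singleton, h]
  ring

theorem fullJumpProb_add_le_one (k : ℤ) :
    fullJumpProb u lam ω k (k + 1) + fullJumpProb u lam ω k (k - 1) ≤ 1 := by
  have := jumpProb_nonneg u lam 1 ω k k
  rw [jumpProb_one_self] at this
  linarith

theorem tsum_mul_stepPMF_one (h : ℤ → ℝ≥0∞) (k : ℤ) :
    ∑' j, h j * stepPMF u lam 1 ω k j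
      = h (k - 1) * ENNReal.ofReal (fullJumpProb u lam ω k (k - 1))
        + (h k * ENNReal.ofReal
            (1 - fullJumpProb u lam ω k (k + 1) - fullJumpProb u lam ω k (k - 1))
        + h (k + 1) * ENNReal.ofReal (fullJumpProb u lam ω k (k + 1))) := by
  rw [tsum_eq_sum (s := Finset.Icc (k - ((1 : ℕ) : ℤ)) (k + ((1 : ℕ) : ℤ)))]
  · rw [Icc_sub_one_add_one, Finset.sum_insert (by simp; omega), Finset.sum_insert (by simp),
      Finset.sum_singleton]
    simp only [stepPMF_apply]
    rw [jumpProb_one_of_abs_eq_one u lam ω (i := k) (j := k - 1) (by simp),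
      jumpProb_one_of_abs_eq_one u lam ω (i := k) (j := k + 1) (by simp), jumpProb_one_self]
  · intro j hj
    have h1 : k ≠ j := by
      rintro rfl
      exact hj (by simp)
    have h2 : ¬ |k - j| ≤ ((1 : ℕ) : ℤ) := fun h => by
      have := abs_le.1 h
      exact hj (Finset.mem_Icc.2 ⟨by omega, by omega⟩)
    rw [stepPMF_apply, jumpProb, if_neg h1, if_neg h2, ENNReal.ofReal_zero, mul_zero]

theorem tsum_ofReal_mul_stepPMF_one {h : ℤ → ℝ} (hh : ∀ k, 0 ≤ h k) (k : ℤ) :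
    ∑' j, ENNReal.ofReal (h j) * stepPMF u lam 1 ω k j
      = ENNReal.ofReal (h k + fullJumpProb u lam ω k (k + 1) * (h (k + 1) - h k)
        + fullJumpProb u lam ω k (k - 1) * (h (k - 1) - h k)) := by
  have h1 := fullJumpProb_add_le_one u lam ω k
  have h2 := fullJumpProb_nonneg u lam ω k (k + 1)
  have h3 := fullJumpProb_nonneg u lam ω k (k - 1)
  have h4 : 0 ≤ 1 - fullJumpProb u lam ω k (k + 1) - fullJumpProb u lam ω k (k - 1) := by linarith
  rw [tsum_mul_stepPMF_one, ← ENNReal.ofReal_mul (hh _), ← ENNReal.ofReal_mul (hh _),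
    ← ENNReal.ofReal_mul (hh _), ← ENNReal.ofReal_add (mul_nonneg (hh _) h4)
      (mul_nonneg (hh _) h2), ← ENNReal.ofReal_add (mul_nonneg (hh _) h3)
      (add_nonneg (mul_nonneg (hh _) h4) (mul_nonneg (hh _) h2))]
  congr 1
  ring

theorem lintegral_walkLaw_step (i : ℤ) (n : ℕ) (F : ℤ → ℤ → ℝ≥0∞) :
    ∫⁻ X, F (X n) (X (n + 1)) ∂walkLaw u lam 1 ω i
      = ∫⁻ X, ∑' j, F (X n) j * stepPMF u lam 1 ω (X n) j ∂walkLaw u lam 1 ω i :=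
  lintegral_walkLaw_succ u lam 1 ω i n fun z j => F (z ⟨n, Finset.mem_Iic.2 le_rfl⟩) j

theorem ae_abs_walk_sub_le (i : ℤ) :
    ∀ᵐ X ∂walkLaw u lam 1 ω i, ∀ n, |X (n + 1) - X n| ≤ 1 := by
  refine ae_all_iff.2 fun n => ?_
  -- `F` vanishes exactly on the admissible jumps, so its mean along one step is zero.
  obtain ⟨F, hF⟩ : ∃ F : ℤ → ℤ → ℝ≥0∞, ∀ k j, F k j = 0 ↔ |j - k| ≤ 1 := by
    classical
    exact ⟨fun k j => if |j - k| ≤ 1 then 0 else 1, fun k j => by simp⟩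
  have h2 : ∀ k : ℤ, ∑' j, F k j * stepPMF u lam 1 ω k j = 0 := by
    intro k
    rw [tsum_mul_stepPMF_one, (hF k k).2 (by simp), (hF k (k - 1)).2 (by simp),
      (hF k (k + 1)).2 (by simp)]
    simp
  have h3 := lintegral_walkLaw_step u lam ω i n F
  simp only [h2, lintegral_zero] at h3
  have hm : Measurable fun X : ℕ → ℤ => (X n, X (n + 1)) :=
    (measurable_pi_apply n).prodMk (measurable_pi_apply (n + 1))
  have hFm : Measurable fun z : ℤ × ℤ => F z.1 z.2 := Measurable.of_discrete
  filter_upwards [(lintegral_eq_zero_iff (hFm.comp hm)).1 h3] with X hX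
  exact (hF _ _).1 hX

theorem ae_abs_walk_le (i : ℤ) : ∀ᵐ X ∂walkLaw u lam 1 ω i, ∀ n : ℕ, |X n - i| ≤ n := by
  filter_upwards [ae_abs_walk_sub_le u lam ω i, ae_walkLaw_zero u lam 1 ω i] with X h1 h2 n
  induction n with
  | zero => simp [h2]
  | succ n ih =>
    have := abs_le.1 (h1 n)
    have := abs_le.1 ih
    exact abs_le.2 ⟨by push_cast; omega, by push_cast; omega⟩

/-- A function with bounded increments and drift at most one grows at most linearly with slope one
along the walk. -/
theorem ae_le_of_drift_le_one {φ : ℤ → ℝ} {M : ℝ} (hM : ∀ k, |φ (k + 1) - φ k| ≤ M)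
    (hφ : ∀ k, fullJumpProb u lam ω k (k + 1) * (φ (k + 1) - φ k)
      + fullJumpProb u lam ω k (k - 1) * (φ (k - 1) - φ k) ≤ 1) (i : ℤ) :
    ∀ᵐ X ∂walkLaw u lam 1 ω i, ∀ ε : ℝ, 0 < ε → ∃ C : ℝ, ∀ n : ℕ, φ (X n) ≤ (1 + ε) * n + C := by
  refine ae_forall_pos_of_forall_pos ?_ ?_
  · rintro x a b - hab ⟨C, hC⟩
    refine ⟨C, fun n => (hC n).trans ?_⟩
    gcongr
  intro ε hε
  have hM0 : 0 ≤ M := (abs_nonneg _).trans (hM 0)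
  -- `θ` is so small that the second-order error `θ² M²` of the exponential is at most `θ ε / 2`.
  obtain ⟨θ, hθ, hθM, hθM2⟩ : ∃ θ : ℝ, 0 < θ ∧ θ * M ≤ 1 ∧ θ * M ^ 2 ≤ ε / 2 := by
    refine ⟨min 1 (ε / 2) / (M + 1) ^ 2, by positivity, ?_, ?_⟩
    · rw [div_mul_eq_mul_div, div_le_one (by positivity)]
      calc min 1 (ε / 2) * M ≤ 1 * M := by gcongr; exact min_le_left _ _
        _ ≤ (M + 1) ^ 2 := by nlinarith
    · rw [div_mul_eq_mul_div, div_le_iff₀ (by positivity)]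
      have h1 : M ^ 2 ≤ (M + 1) ^ 2 := by nlinarith
      exact mul_le_mul (min_le_right _ _) h1 (sq_nonneg M) (by positivity)
  have hexp : ∀ x : ℝ, |x| ≤ M → Real.exp (θ * x) - 1 ≤ θ * x + θ ^ 2 * M ^ 2 := by
    intro x hx
    have h1 : |θ * x| ≤ θ * M := by
      rw [abs_mul, abs_of_pos hθ]
      gcongr
    have h2 := (abs_le.1 (Real.abs_exp_sub_one_sub_id_le (h1.trans hθM))).2
    have h3 : (θ * x) ^ 2 ≤ (θ * M) ^ 2 := sq_le_sq' (abs_le.1 h1).1 (abs_le.1 h1).2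
    nlinarith
  set h : ℤ → ℝ := fun k => Real.exp (θ * φ k)
  -- Drift at most one for `φ` becomes growth of `exp (θ φ)` by at most the factor `exp (θ (1 + ε /
  -- 2))` per step.
  have hdrift : ∀ k, ∑' j, ENNReal.ofReal (h j) * stepPMF u lam 1 ω k j
      ≤ ENNReal.ofReal (Real.exp (θ * (1 + ε / 2))) * ENNReal.ofReal (h k) := by
    intro k
    rw [tsum_ofReal_mul_stepPMF_one _ _ _ fun k => (Real.exp_pos _).le,
      ← ENNReal.ofReal_mul (Real.exp_pos _).le]
    refine ENNReal.ofReal_le_ofReal ?_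
    have e1 : ∀ j, h j - h k = h k * (Real.exp (θ * (φ j - φ k)) - 1) := by
      intro j
      simp only [h]
      rw [mul_sub, ← Real.exp_add]
      ring_nf
    rw [e1, e1]
    have a1 := hexp _ (hM k)
    have a2 := hexp (φ (k - 1) - φ k) (by
      have := hM (k - 1)
      rwa [sub_add_cancel, abs_sub_comm] at this)
    have hp := fullJumpProb_nonneg u lam ω k (k + 1)
    have hq := fullJumpProb_nonneg u lam ω k (k - 1)
    have hpq := fullJumpProb_add_le_one u lam ω k
    have hd := hφ k
    set p := fullJumpProb u lam ω k (k + 1)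
    set q := fullJumpProb u lam ω k (k - 1)
    have hk : 0 < h k := Real.exp_pos _
    have b1 := mul_le_mul_of_nonneg_left a1 hp
    have b2 := mul_le_mul_of_nonneg_left a2 hq
    have b3 : (p + q) * (θ ^ 2 * M ^ 2) ≤ 1 * (θ * (ε / 2)) := by
      refine mul_le_mul hpq ?_ (by positivity) zero_le_one
      nlinarith
    have b4 := mul_le_mul_of_nonneg_left hd hθ.le
    have b5 := Real.add_one_le_exp (θ * (1 + ε / 2))
    calc h k + p * (h k * (Real.exp (θ * (φ (k + 1) - φ k)) - 1))
          + q * (h k * (Real.exp (θ * (φ (k - 1) - φ k)) - 1))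
        = (1 + p * (Real.exp (θ * (φ (k + 1) - φ k)) - 1)
          + q * (Real.exp (θ * (φ (k - 1) - φ k)) - 1)) * h k := by ring
      _ ≤ Real.exp (θ * (1 + ε / 2)) * h k := by
        gcongr
        nlinarith
  have hhm : ∀ n, Measurable fun X : ℕ → ℤ => ENNReal.ofReal (h (X n)) := fun n =>
    (Measurable.of_discrete (f := fun k : ℤ => ENNReal.ofReal (h k))).comp (measurable_pi_apply n)
  have hint := lintegral_walkLaw_le u lam 1 ω hdrift i
  -- Discounting at rate `θ (1 + ε)` leaves a geometric series of ratio `exp (-θ ε / 2)`. The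
  -- discounted sum is thus almost surely finite and bounds every term.
  have hsum : ∫⁻ X, ∑' n : ℕ, ENNReal.ofReal (Real.exp (-(θ * (1 + ε)) * n))
      * ENNReal.ofReal (h (X n)) ∂walkLaw u lam 1 ω i ≠ ∞ := by
    rw [lintegral_tsum fun n => ((hhm n).const_mul _).aemeasurable]
    refine ne_top_of_le_ne_top ?_ (ENNReal.tsum_le_tsum
      (g := fun n : ℕ => ENNReal.ofReal (Real.exp (-(θ * (ε / 2)))) ^ n * ENNReal.ofReal (h i))
      fun n => ?_)
    · rw [ENNReal.tsum_mul_right, ENNReal.tsum_geometric]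
      refine ENNReal.mul_ne_top (ENNReal.inv_ne_top.2 (tsub_pos_of_lt ?_).ne') ENNReal.ofReal_ne_top
      rw [ENNReal.ofReal_lt_one, Real.exp_lt_one_iff]
      have : 0 < θ * (ε / 2) := by positivity
      linarith
    · rw [lintegral_const_mul _ (hhm n)]
      refine (mul_le_mul_right (hint n) _).trans_eq ?_
      rw [← mul_assoc, ← ENNReal.ofReal_pow (Real.exp_pos _).le,
        ← ENNReal.ofReal_pow (Real.exp_pos _).le, ← ENNReal.ofReal_mul (Real.exp_pos _).le,
        ← Real.exp_nat_mul, ← Real.exp_nat_mul, ← Real.exp_add]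
      congr 3
      ring
  have hmeas : Measurable fun X : ℕ → ℤ => ∑' n : ℕ,
      ENNReal.ofReal (Real.exp (-(θ * (1 + ε)) * n)) * ENNReal.ofReal (h (X n)) :=
    Measurable.tsum fun n => (hhm n).const_mul _
  filter_upwards [ae_lt_top hmeas hsum] with X hX
  set S := ∑' n : ℕ, ENNReal.ofReal (Real.exp (-(θ * (1 + ε)) * n)) * ENNReal.ofReal (h (X n))
  -- The inequality `x + 1 ≤ exp x` replaces taking a logarithm of the bound by `S`.
  refine ⟨S.toReal / θ, fun n => ?_⟩
  have h1 : ENNReal.ofReal (Real.exp (-(θ * (1 + ε)) * n) * h (X n)) ≤ S := by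
    rw [ENNReal.ofReal_mul (Real.exp_pos _).le]
    exact ENNReal.le_tsum (f := fun n : ℕ =>
      ENNReal.ofReal (Real.exp (-(θ * (1 + ε)) * n)) * ENNReal.ofReal (h (X n))) n
  have h2 := (ENNReal.ofReal_le_iff_le_toReal hX.ne).1 h1
  rw [← Real.exp_add] at h2
  have h3 := Real.add_one_le_exp (-(θ * (1 + ε)) * n + θ * φ (X n))
  rw [← sub_le_iff_le_add', le_div_iff₀ hθ]
  nlinarith

end NearestNeighbour

/-! ### Additive cocycles over the environment and the resulting speed bound. -/

section Cocycle

/-- The additive cocycle with increments `g`. -/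
noncomputable def cocycle (g : Env → ℝ) (ω : Env) (k : ℤ) : ℝ :=
  ∑ j ∈ Finset.Ico 0 k, g (shift j ω) - ∑ j ∈ Finset.Ico k 0, g (shift j ω)

theorem cocycle_succ (g : Env → ℝ) (ω : Env) (k : ℤ) :
    cocycle g ω (k + 1) = cocycle g ω k + g (shift k ω) := by
  unfold cocycle
  rcases le_or_gt 0 k with h | h
  · rw [Finset.Ico_eq_empty_of_le h, Finset.Ico_eq_empty_of_le (by omega : (0 : ℤ) ≤ k + 1),
      ← Finset.insert_Ico_right_eq_Ico_add_one h, Finset.sum_insert (by simp)]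
    simp [add_comm]
  · rw [Finset.Ico_eq_empty_of_le (by omega : k ≤ 0),
      Finset.Ico_eq_empty_of_le (by omega : k + 1 ≤ 0),
      ← Finset.insert_Ico_add_one_left_eq_Ico h, Finset.sum_insert (by simp)]
    simp

theorem cocycle_natCast (g : Env → ℝ) (ω : Env) (n : ℕ) :
    cocycle g ω n = birkhoffSum (shift 1) g n ω := by
  induction n with
  | zero => simp [cocycle]
  | succ n ih =>
    rw [Nat.cast_succ, cocycle_succ, ih, birkhoffSum_succ, iterate_shift, mul_one]

theorem cocycle_neg_natCast (g : Env → ℝ) (ω : Env) (n : ℕ) :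
    cocycle g ω (-n) = -birkhoffSum (shift (-1)) (fun ω => g (shift (-1) ω)) n ω := by
  induction n with
  | zero => simp [cocycle]
  | succ n ih =>
    have := cocycle_succ g ω (-((n + 1 : ℕ) : ℤ))
    rw [show -((n + 1 : ℕ) : ℤ) + 1 = -n by push_cast; ring, ih] at this
    rw [birkhoffSum_succ, iterate_shift, shift_shift,
      show (-1 : ℤ) + n * -1 = -((n + 1 : ℕ) : ℤ) by push_cast; ring]
    linarith

variable {P : Measure Env}

/-- Birkhoff's theorem for the shift controls `k ≥ 0`, and for the inverse shift `k ≤ 0`. -/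
theorem IsEnvLaw.ae_abs_cocycle_sub_le (hP : IsEnvLaw P) {g : Env → ℝ} (hgm : Measurable g)
    (hg : Integrable g P) : ∀ᵐ ω ∂P, ∀ ε : ℝ, 0 < ε → ∃ C : ℝ, ∀ k : ℤ,
      |cocycle g ω k - (∫ ω, g ω ∂P) * k| ≤ ε * |(k : ℝ)| + C := by
  have := hP.isProbabilityMeasure
  have hs := hP.measurePreserving_shift (-1)
  have hi : ∫ ω, g (shift (-1) ω) ∂P = ∫ ω, g ω ∂P := by
    have := integral_map (μ := P) hs.aemeasurable (f := g)
      (by rw [hs.map_eq]; exact hg.1)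
    rw [hs.map_eq] at this
    exact this.symm
  have h2 := ae_abs_birkhoffSum_sub_le hP.ergodic_neg (hgm.comp hs.measurable)
    (hs.integrable_comp_of_integrable hg)
  filter_upwards [ae_abs_birkhoffSum_sub_le hP.ergodic hgm hg, h2] with ω h1 h2 ε hε
  obtain ⟨C1, hC1⟩ := h1 ε hε
  obtain ⟨C2, hC2⟩ := h2 ε hε
  refine ⟨max C1 C2, fun k => ?_⟩
  obtain ⟨n, rfl | rfl⟩ := k.eq_nat_or_neg
  · rw [cocycle_natCast]
    have h := hC1 n
    simp only [Int.cast_natCast, Nat.abs_cast]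
    linarith [le_max_left C1 C2]
  · rw [cocycle_neg_natCast]
    have h := hC2 n
    simp only [Function.comp_def, hi] at h
    simp only [Int.cast_neg, Int.cast_natCast, abs_neg, Nat.abs_cast]
    rw [abs_sub_comm] at h
    rw [show -birkhoffSum (shift (-1)) (fun ω => g (shift (-1) ω)) n ω
      - (∫ ω, g ω ∂P) * -(n : ℝ) = (∫ ω, g ω ∂P) * n
        - birkhoffSum (shift (-1)) (fun ω => g (shift (-1) ω)) n ω by ring]
    linarith [le_max_right C1 C2]

/-- If the cocycle with bounded increments `g` has drift at most one along the walk, then the speed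
is at most the inverse of the mean of `g`. -/
theorem IsEnvLaw.ae_integral_mul_walk_le (hP : IsEnvLaw P) (u : ℝ → ℝ → ℝ) (lam : ℝ)
    {g : Env → ℝ} (hgm : Measurable g) {M : ℝ} (hM : ∀ ω, |g ω| ≤ M)
    (hdrift : ∀ ω, fullJumpProb u lam ω 0 1 * g ω
      - fullJumpProb u lam ω 0 (-1) * g (shift (-1) ω) ≤ 1) :
    ∀ᵐ ω ∂P, ∀ᵐ X ∂walkLaw u lam 1 ω 0, ∀ ε : ℝ, 0 < ε → ∃ C : ℝ, ∀ n : ℕ,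
      (∫ ω, g ω ∂P) * X n ≤ (1 + ε) * n + C := by
  have := hP.isProbabilityMeasure
  have hg : Integrable g P := Integrable.of_bound hgm.aestronglyMeasurable M (ae_of_all _ hM)
  filter_upwards [hP.ae_abs_cocycle_sub_le hgm hg] with ω hω
  have h1 := ae_le_of_drift_le_one u lam ω (φ := cocycle g ω) (M := M)
    (fun k => by rw [cocycle_succ, add_sub_cancel_left]; exact hM _)
    (fun k => by
      have h2 := cocycle_succ g ω (k - 1)
      rw [sub_add_cancel] at h2
      have h3 := hdrift (shift k ω)
      rw [fullJumpProb_shift, fullJumpProb_shift, shift_shift] at h3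
      rw [cocycle_succ, h2]
      rw [zero_add, add_comm 1 k, neg_add_eq_sub] at h3
      linarith) 0
  filter_upwards [h1, ae_abs_walk_le u lam ω 0] with X hX hXn ε hε
  obtain ⟨C1, hC1⟩ := hX (ε / 2) (half_pos hε)
  obtain ⟨C2, hC2⟩ := hω (ε / 2) (half_pos hε)
  refine ⟨C1 + C2, fun n => ?_⟩
  have h4 := hC1 n
  have h5 := (abs_le.1 (hC2 (X n))).1
  -- The walk moves at most one site per step, which turns the error `ε / 2 * |X n|` of the cocycle
  -- into `ε / 2 * n`.
  have h6 : |(X n : ℝ)| ≤ n := by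
    have := hXn n
    rw [sub_zero] at this
    exact_mod_cast this
  nlinarith

end Cocycle

/-! ### Crossing times from the one-step recursion, and their capped versions. -/

section CrossingTime

variable {α : Type*}

/-- The mean time to leave to the side of `p` for the chain with jump probabilities `p` and `q`,
with at most `m` sites taken into account; `T` moves to the neighbour on the side of `q`. -/
noncomputable def crossingTime (T : α → α) (p q : α → ℝ) : ℕ → α → ℝ
  | 0, _ => 0
  | m + 1, x => (1 + q x * crossingTime T p q m (T x)) / p x

/-- The variant of `crossingTime` that is capped at `M` in each step. -/
noncomputable def cappedTime (T : α → α) (p q : α → ℝ) (M : ℝ) : ℕ → α → ℝ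
  | 0, _ => 0
  | m + 1, x => min M ((1 + q x * cappedTime T p q M m (T x)) / p x)

variable {T : α → α} {p q : α → ℝ} (hp : ∀ x, 0 ≤ p x) (hq : ∀ x, 0 ≤ q x)
include hp hq

variable {M : ℝ} (hM : 0 ≤ M)
include hM

theorem cappedTime_nonneg (m : ℕ) (x : α) : 0 ≤ cappedTime T p q M m x := by
  induction m generalizing x with
  | zero => exact le_rfl
  | succ m ih =>
    exact le_min hM
      (div_nonneg (add_nonneg zero_le_one (mul_nonneg (hq x) (ih (T x)))) (hp x))

theorem abs_cappedTime_le (m : ℕ) (x : α) : |cappedTime T p q M m x| ≤ M := by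
  rw [abs_of_nonneg (cappedTime_nonneg hp hq hM m x)]
  cases m with
  | zero => exact hM
  | succ m => exact min_le_left _ _

theorem cappedTime_le_succ (m : ℕ) (x : α) :
    cappedTime T p q M m x ≤ cappedTime T p q M (m + 1) x := by
  induction m generalizing x with
  | zero => exact cappedTime_nonneg hp hq hM 1 x
  | succ m ih =>
    refine min_le_min le_rfl (div_le_div_of_nonneg_right ?_ (hp x))
    exact add_le_add le_rfl (mul_le_mul_of_nonneg_left (ih (T x)) (hq x))

/-- The recursion bounds `p` times the time at level `m + 1` by `1 + q` times the neighbour's time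
at level `m`, and monotonicity lowers the former to level `m`. The cap only helps, and it supplies
the bounded increments that the exponential estimate needs. -/
theorem drift_cappedTime_le_one (m : ℕ) (x : α) :
    p x * cappedTime T p q M m x - q x * cappedTime T p q M m (T x) ≤ 1 := by
  have h1 := mul_le_mul_of_nonneg_left (cappedTime_le_succ (T := T) hp hq hM m x) (hp x)
  have h2 : p x * cappedTime T p q M (m + 1) x ≤ 1 + q x * cappedTime T p q M m (T x) := by
    have h3 := cappedTime_nonneg (T := T) hp hq hM m (T x)
    have h4 : 0 ≤ 1 + q x * cappedTime T p q M m (T x) :=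
      add_nonneg zero_le_one (mul_nonneg (hq x) h3)
    refine (mul_le_mul_of_nonneg_left (min_le_right _ _) (hp x)).trans ?_
    -- For `p x = 0` the left side is zero whatever the value of the quotient.
    rcases (hp x).eq_or_lt with h | h
    · rw [← h, zero_mul]
      exact h4
    · rw [mul_div_cancel₀ _ h.ne']
  linarith

omit hM hp hq in
-- For fixed `m` and `x` only finitely many caps are involved, so they all become inactive once `M`
-- is large.
theorem exists_cappedTime_eq (T : α → α) (p q : α → ℝ) (m : ℕ) (x : α) :
    ∃ M₀ : ℝ, ∀ M, M₀ ≤ M → cappedTime T p q M m x = crossingTime T p q m x := by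
  induction m generalizing x with
  | zero => exact ⟨0, fun M _ => rfl⟩
  | succ m ih =>
    obtain ⟨M₁, hM₁⟩ := ih (T x)
    refine ⟨max M₁ (crossingTime T p q (m + 1) x), fun M hM => ?_⟩
    rw [cappedTime, hM₁ M ((le_max_left _ _).trans hM)]
    exact min_eq_right ((le_max_right _ _).trans hM)

end CrossingTime

/-! ### Approximating the mean crossing time by means of capped times. -/

section CrossingTimeMeasure

variable {α : Type*} [MeasurableSpace α] {T : α → α} {p q : α → ℝ} (hT : Measurable T)
  (hpm : Measurable p) (hqm : Measurable q)
include hT hpm hqm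

theorem measurable_crossingTime (m : ℕ) : Measurable (crossingTime T p q m) := by
  induction m with
  | zero => exact measurable_const
  | succ m ih => exact ((hqm.mul (ih.comp hT)).const_add 1).div hpm

theorem measurable_cappedTime (M : ℝ) (m : ℕ) : Measurable (cappedTime T p q M m) := by
  induction m with
  | zero => exact measurable_const
  | succ m ih => exact measurable_const.min (((hqm.mul (ih.comp hT)).const_add 1).div hpm)

/-- Monotone convergence yields a level `m`; then Fatou's lemma yields a cap `M`, as the capped
times are eventually constant in `M` at each point. -/
theorem exists_lt_lintegral_cappedTime {μ : Measure α}
    {B : ℝ≥0∞} (hmono : ∀ᵐ x ∂μ, Monotone fun m => ENNReal.ofReal (crossingTime T p q m x))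
    (hB : B < ∫⁻ x, ⨆ m, ENNReal.ofReal (crossingTime T p q m x) ∂μ) :
    ∃ m M : ℕ, B < ∫⁻ x, ENNReal.ofReal (cappedTime T p q M m x) ∂μ := by
  rw [lintegral_iSup' (fun m => (measurable_crossingTime hT hpm hqm m).ennreal_ofReal.aemeasurable)
    hmono, lt_iSup_iff] at hB
  obtain ⟨m, hm⟩ := hB
  refine ⟨m, ?_⟩
  by_contra! hc
  refine hm.not_ge ?_
  calc ∫⁻ x, ENNReal.ofReal (crossingTime T p q m x) ∂μ
      = ∫⁻ x, liminf (fun M : ℕ => ENNReal.ofReal (cappedTime T p q M m x)) atTop ∂μ := by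
        refine lintegral_congr fun x => ?_
        obtain ⟨M₀, hM₀⟩ := exists_cappedTime_eq T p q m x
        obtain ⟨N, hN⟩ := exists_nat_ge M₀
        refine (Tendsto.liminf_eq (tendsto_const_nhds.congr' ?_)).symm
        filter_upwards [eventually_ge_atTop N] with M hM
        rw [hM₀ M (hN.trans (by exact_mod_cast hM))]
    _ ≤ liminf (fun M : ℕ => ∫⁻ x, ENNReal.ofReal (cappedTime T p q M m x) ∂μ) atTop :=
        lintegral_liminf_le fun M => (measurable_cappedTime hT hpm hqm M m).ennreal_ofReal
    _ ≤ B := liminf_le_of_le (by isBoundedDefault) fun b hb => by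
        obtain ⟨M, hM⟩ := hb.exists
        exact hM.trans (hc M)

end CrossingTimeMeasure

/-! ### Explicit crossing times and almost sure speed bounds in both directions. -/

section Speed

variable {P : Measure Env} (hP : IsEnvLaw P) {u : ℝ → ℝ → ℝ}
  (hu : Measurable (Function.uncurry u)) (lam : ℝ)

/-- The mean time to cross from `0` to `1`, as a series over the sites to the left of `1`. -/
noncomputable def rightTime (u : ℝ → ℝ → ℝ) (lam : ℝ) (ω : Env) : ℝ≥0∞ :=
  ∑' j : ℕ, ENNReal.ofReal (totalConductance u lam ω (-j) / conductance u lam ω 0 1)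

/-- The mean time to cross from `0` to `-1`, as a series over the sites to the right of `-1`. -/
noncomputable def leftTime (u : ℝ → ℝ → ℝ) (lam : ℝ) (ω : Env) : ℝ≥0∞ :=
  ∑' j : ℕ, ENNReal.ofReal (totalConductance u lam ω j / conductance u lam ω 0 (-1))

/-- The recursion is solved by reversibility: `conductance u lam ω k (k - 1)` in the jump
probability cancels against the denominator of the crossing time from `k - 1` to `k`. -/
theorem crossingTime_right {u : ℝ → ℝ → ℝ} {lam : ℝ} {ω : Env}
    (hu_symm : ∀ a b : ℝ, u a b = u b a) (hpos : ∀ k, 0 < totalConductance u lam ω k)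
    (m : ℕ) (k : ℤ) :
    crossingTime (shift (-1)) (fun ω => fullJumpProb u lam ω 0 1)
      (fun ω => fullJumpProb u lam ω 0 (-1)) m (shift k ω)
      = ∑ j ∈ Finset.range m, totalConductance u lam ω (k - j) / conductance u lam ω k (k + 1) := by
  induction m generalizing k with
  | zero => simp [crossingTime]
  | succ m ih =>
    have h1 := hpos k
    have h2 : 0 < conductance u lam ω k (k + 1) := conductance_pos (by omega)
    have h3 : 0 < conductance u lam ω (k - 1) k := conductance_pos (by omega)
    rw [crossingTime, shift_shift, fullJumpProb_shift, fullJumpProb_shift, neg_add_eq_sub,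
      ih (k - 1), sub_add_cancel, Finset.sum_range_succ', zero_add, add_comm 1 k, fullJumpProb_eq,
      fullJumpProb_eq, conductance_symm hu_symm k (k - 1), ← Finset.sum_div, ← Finset.sum_div]
    have h4 : ∀ j : ℕ, k - 1 - (j : ℤ) = k - ((j + 1 : ℕ) : ℤ) := fun j => by push_cast; ring
    simp only [h4, Nat.cast_zero, sub_zero]
    field_simp
    ring

theorem crossingTime_left {u : ℝ → ℝ → ℝ} {lam : ℝ} {ω : Env}
    (hu_symm : ∀ a b : ℝ, u a b = u b a) (hpos : ∀ k, 0 < totalConductance u lam ω k)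
    (m : ℕ) (k : ℤ) :
    crossingTime (shift 1) (fun ω => fullJumpProb u lam ω 0 (-1))
      (fun ω => fullJumpProb u lam ω 0 1) m (shift k ω)
      = ∑ j ∈ Finset.range m, totalConductance u lam ω (k + j) / conductance u lam ω k (k - 1) := by
  induction m generalizing k with
  | zero => simp [crossingTime]
  | succ m ih =>
    have h1 := hpos k
    have h2 : 0 < conductance u lam ω k (k - 1) := conductance_pos (by omega)
    have h3 : 0 < conductance u lam ω (k + 1) k := conductance_pos (by omega)
    rw [crossingTime, shift_shift, fullJumpProb_shift, fullJumpProb_shift, neg_add_eq_sub,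
      add_comm 1 k, ih (k + 1), add_sub_cancel_right, Finset.sum_range_succ', zero_add,
      fullJumpProb_eq, fullJumpProb_eq, conductance_symm hu_symm k (k + 1), ← Finset.sum_div,
      ← Finset.sum_div]
    have h4 : ∀ j : ℕ, k + 1 + (j : ℤ) = k + ((j + 1 : ℕ) : ℤ) := fun j => by push_cast; ring
    simp only [h4, Nat.cast_zero, add_zero]
    field_simp
    ring

theorem monotone_iSup_crossingTime_right {u : ℝ → ℝ → ℝ} {lam : ℝ} {ω : Env}
    (hu_symm : ∀ a b : ℝ, u a b = u b a) (hpos : ∀ k, 0 < totalConductance u lam ω k) :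
    (Monotone fun m => ENNReal.ofReal (crossingTime (shift (-1)) (fun ω => fullJumpProb u lam ω 0 1)
      (fun ω => fullJumpProb u lam ω 0 (-1)) m ω)) ∧
    ⨆ m, ENNReal.ofReal (crossingTime (shift (-1)) (fun ω => fullJumpProb u lam ω 0 1)
      (fun ω => fullJumpProb u lam ω 0 (-1)) m ω) = rightTime u lam ω := by
  have h : ∀ m, ENNReal.ofReal (crossingTime (shift (-1)) (fun ω => fullJumpProb u lam ω 0 1)
      (fun ω => fullJumpProb u lam ω 0 (-1)) m ω) = ∑ j ∈ Finset.range m,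
        ENNReal.ofReal (totalConductance u lam ω (-j) / conductance u lam ω 0 1) := by
    intro m
    have h1 := crossingTime_right hu_symm hpos m 0
    simp only [shift_zero, zero_sub, zero_add] at h1
    rw [h1, ENNReal.ofReal_sum_of_nonneg fun j _ =>
      div_nonneg (hpos _).le (conductance_nonneg _ _ _ _ _)]
  simp only [h]
  exact ⟨fun a b hab => Finset.sum_le_sum_of_subset (Finset.range_mono hab),
    ENNReal.tsum_eq_iSup_nat.symm⟩

theorem monotone_iSup_crossingTime_left {u : ℝ → ℝ → ℝ} {lam : ℝ} {ω : Env}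
    (hu_symm : ∀ a b : ℝ, u a b = u b a) (hpos : ∀ k, 0 < totalConductance u lam ω k) :
    (Monotone fun m => ENNReal.ofReal (crossingTime (shift 1) (fun ω => fullJumpProb u lam ω 0 (-1))
      (fun ω => fullJumpProb u lam ω 0 1) m ω)) ∧
    ⨆ m, ENNReal.ofReal (crossingTime (shift 1) (fun ω => fullJumpProb u lam ω 0 (-1))
      (fun ω => fullJumpProb u lam ω 0 1) m ω) = leftTime u lam ω := by
  have h : ∀ m, ENNReal.ofReal (crossingTime (shift 1) (fun ω => fullJumpProb u lam ω 0 (-1))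
      (fun ω => fullJumpProb u lam ω 0 1) m ω) = ∑ j ∈ Finset.range m,
        ENNReal.ofReal (totalConductance u lam ω j / conductance u lam ω 0 (-1)) := by
    intro m
    have h1 := crossingTime_left hu_symm hpos m 0
    simp only [shift_zero, zero_sub, zero_add] at h1
    rw [h1, ENNReal.ofReal_sum_of_nonneg fun j _ =>
      div_nonneg (hpos _).le (conductance_nonneg _ _ _ _ _)]
  simp only [h]
  exact ⟨fun a b hab => Finset.sum_le_sum_of_subset (Finset.range_mono hab),
    ENNReal.tsum_eq_iSup_nat.symm⟩

include hP hu

theorem ae_mul_walk_le (hu_symm : ∀ a b : ℝ, u a b = u b a)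
    (hpos : ∀ᵐ ω ∂P, ∀ k, 0 < totalConductance u lam ω k) {b : ℝ} (hb : 0 ≤ b)
    (h : ENNReal.ofReal b < ∫⁻ ω, rightTime u lam ω ∂P) :
    ∀ᵐ ω ∂P, ∀ᵐ X ∂walkLaw u lam 1 ω 0, ∀ ε : ℝ, 0 < ε → ∃ C : ℝ, ∀ n : ℕ,
      b * X n ≤ (1 + ε) * n + C := by
  have := hP.isProbabilityMeasure
  have hpm := measurable_fullJumpProb hu lam 0 1
  have hqm := measurable_fullJumpProb hu lam 0 (-1)
  have hp := fun ω => fullJumpProb_nonneg u lam ω 0 1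
  have hq := fun ω => fullJumpProb_nonneg u lam ω 0 (-1)
  rw [← lintegral_congr_ae (hpos.mono fun ω hω =>
    (monotone_iSup_crossingTime_right hu_symm hω).2)] at h
  obtain ⟨m, M, hmM⟩ := exists_lt_lintegral_cappedTime (measurable_shift (-1)) hpm hqm
    (hpos.mono fun ω hω => (monotone_iSup_crossingTime_right hu_symm hω).1) h
  set g : Env → ℝ := cappedTime (shift (-1)) (fun ω => fullJumpProb u lam ω 0 1)
      (fun ω => fullJumpProb u lam ω 0 (-1)) M m
  have hgm : Measurable g := measurable_cappedTime (measurable_shift (-1)) hpm hqm M m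
  have hgM : ∀ ω, |g ω| ≤ M := abs_cappedTime_le hp hq (Nat.cast_nonneg M) m
  have hgi : Integrable g P := Integrable.of_bound hgm.aestronglyMeasurable M (ae_of_all _ hgM)
  rw [← ofReal_integral_eq_lintegral_ofReal hgi
    (ae_of_all _ (cappedTime_nonneg hp hq (Nat.cast_nonneg M) m)),
    ENNReal.ofReal_lt_ofReal_iff_of_nonneg hb] at hmM
  filter_upwards [hP.ae_integral_mul_walk_le u lam hgm hgM
    (drift_cappedTime_le_one hp hq (Nat.cast_nonneg M) m)] with ω hω
  filter_upwards [hω] with X hX ε hε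
  obtain ⟨C, hC⟩ := hX ε hε
  refine ⟨|C|, fun n => ?_⟩
  -- Replacing the mean of `g` by the smaller `b` is legitimate only for `X n ≥ 0`; otherwise the
  -- left side is nonpositive, and `|C|` keeps the right side nonnegative.
  rcases le_or_gt 0 (X n : ℝ) with h0 | h0
  · nlinarith [hC n, le_abs_self C]
  · have : 0 ≤ (1 + ε) * n + |C| := by positivity
    nlinarith

theorem ae_mul_neg_walk_le (hu_symm : ∀ a b : ℝ, u a b = u b a)
    (hpos : ∀ᵐ ω ∂P, ∀ k, 0 < totalConductance u lam ω k) {b : ℝ} (hb : 0 ≤ b)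
    (h : ENNReal.ofReal b < ∫⁻ ω, leftTime u lam ω ∂P) :
    ∀ᵐ ω ∂P, ∀ᵐ X ∂walkLaw u lam 1 ω 0, ∀ ε : ℝ, 0 < ε → ∃ C : ℝ, ∀ n : ℕ,
      b * (-X n) ≤ (1 + ε) * n + C := by
  have := hP.isProbabilityMeasure
  have hpm := measurable_fullJumpProb hu lam 0 1
  have hqm := measurable_fullJumpProb hu lam 0 (-1)
  have hp := fun ω => fullJumpProb_nonneg u lam ω 0 1
  have hq := fun ω => fullJumpProb_nonneg u lam ω 0 (-1)
  rw [← lintegral_congr_ae (hpos.mono fun ω hω =>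
    (monotone_iSup_crossingTime_left hu_symm hω).2)] at h
  obtain ⟨m, M, hmM⟩ := exists_lt_lintegral_cappedTime (measurable_shift 1) hqm hpm
    (hpos.mono fun ω hω => (monotone_iSup_crossingTime_left hu_symm hω).1) h
  set g : Env → ℝ := cappedTime (shift 1) (fun ω => fullJumpProb u lam ω 0 (-1))
      (fun ω => fullJumpProb u lam ω 0 1) M m with hg
  have hgm : Measurable g := measurable_cappedTime (measurable_shift 1) hqm hpm M m
  have hgM : ∀ ω, |g ω| ≤ M := abs_cappedTime_le hq hp (Nat.cast_nonneg M) m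
  have hgi : Integrable g P := Integrable.of_bound hgm.aestronglyMeasurable M (ae_of_all _ hgM)
  rw [← ofReal_integral_eq_lintegral_ofReal hgi
    (ae_of_all _ (cappedTime_nonneg hq hp (Nat.cast_nonneg M) m)),
    ENNReal.ofReal_lt_ofReal_iff_of_nonneg hb] at hmM
  -- The increment over the edge from `k` to `k + 1` is minus the capped time to cross it leftwards
  -- from `k + 1`, hence the shift by one and the sign.
  have hs := hP.measurePreserving_shift 1
  have hi : ∫ ω, -g (shift 1 ω) ∂P = -∫ ω, g ω ∂P := by
    have := integral_map (μ := P) hs.aemeasurable (f := g) (by rw [hs.map_eq]; exact hgi.1)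
    rw [hs.map_eq] at this
    rw [integral_neg, this]
  have hd : ∀ ω, fullJumpProb u lam ω 0 1 * -g (shift 1 ω)
      - fullJumpProb u lam ω 0 (-1) * -g (shift 1 (shift (-1) ω)) ≤ 1 := by
    intro ω
    have := drift_cappedTime_le_one (T := shift 1) hq hp (Nat.cast_nonneg M) m ω
    rw [shift_shift, add_neg_cancel, shift_zero]
    rw [← hg] at this
    linarith
  filter_upwards [hP.ae_integral_mul_walk_le u lam (hgm.comp hs.measurable).neg
    (fun ω => (abs_neg (g (shift 1 ω))).trans_le (hgM _)) hd] with ω hω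
  filter_upwards [hω] with X hX ε hε
  obtain ⟨C, hC⟩ := hX ε hε
  refine ⟨|C|, fun n => ?_⟩
  have hCn : -(∫ ω, g ω ∂P) * X n ≤ (1 + ε) * n + C := by
    rw [← hi]
    exact hC n
  rcases le_or_gt 0 (-X n : ℝ) with h0 | h0
  · nlinarith [le_abs_self C]
  · have : 0 ≤ (1 + ε) * n + |C| := by positivity
    nlinarith

end Speed

/-! ### Comparison of `rightTime` with the series in the theorem when the gaps are bounded below. -/

section GoodEnvironments

theorem IsEnvLaw.exists_ae_le_gap {P : Measure Env} (hP : IsEnvLaw P) :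
    ∃ d : ℝ, 0 < d ∧ ∀ᵐ ω ∂P, ∀ k, d ≤ gap ω k := by
  have := hP.isProbabilityMeasure
  obtain ⟨d, hd, h⟩ := hP.gap_ge
  have h1 : ∀ᵐ ω ∂P, d ≤ gap ω 0 :=
    (mem_ae_iff_prob_eq_one (measurableSet_le measurable_const (measurable_gap 0))).2 h
  refine ⟨d, hd, ?_⟩
  filter_upwards [hP.ae_shift h1] with ω hω k
  have := hω k
  rwa [gap_shift, zero_add] at this

variable {u : ℝ → ℝ → ℝ} {lam : ℝ} {ω : Env} {umin umax : ℝ}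
  (hu_bdd : ∀ a b : ℝ, umin ≤ u a b ∧ u a b ≤ umax) (hlam1 : lam < 1) {d : ℝ} (hd : 0 < d)
  (hω : ∀ k, d ≤ gap ω k) (hlam0 : 0 ≤ lam)

/-- The constant in the comparison of the total conductance with nearest neighbour conductances. -/
noncomputable def comparisonConst (umin umax lam d : ℝ) : ℝ :=
  Real.exp (umax - umin) * (1 - Real.exp (-((1 - lam) * d)))⁻¹

include hu_bdd hlam1 hd hω hlam0

theorem totalConductance_le (k : ℤ) :
    totalConductance u lam ω k ≤ comparisonConst umin umax lam d
      * (conductance u lam ω k (k + 1) + conductance u lam ω k (k - 1)) := by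
  obtain ⟨a, b, -, -, h, ha, hb⟩ := hasSum_conductance hu_bdd hlam1 hd hω hlam0 k
  rw [totalConductance, h.tsum_eq, mul_add]
  exact add_le_add ha hb

theorem conductance_le_totalConductance (k j : ℤ) :
    conductance u lam ω k j ≤ totalConductance u lam ω k := by
  obtain ⟨a, b, -, -, h, -, -⟩ := hasSum_conductance hu_bdd hlam1 hd hω hlam0 k
  exact h.summable.le_tsum j fun i _ => conductance_nonneg _ _ _ _ _

theorem totalConductance_pos (k : ℤ) : 0 < totalConductance u lam ω k :=
  (conductance_pos (by omega : k ≠ k + 1)).trans_le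
    (conductance_le_totalConductance hu_bdd hlam1 hd hω hlam0 k (k + 1))

omit hlam1 in
-- To the right of the origin the bias only increases the conductances, as positions and `lam` are
-- nonnegative.
theorem exp_neg_gap_le_conductance (n : ℕ) :
    Real.exp umin * Real.exp (-gap ω n) ≤ conductance u lam ω n (n + 1) := by
  rw [conductance, if_neg (by omega), ← Real.exp_add]
  refine Real.exp_le_exp.2 ?_
  have h0 := mul_le_pos_sub_pos hω 0 n
  rw [pos_zero, zero_add] at h0
  have h1 : 0 ≤ (n : ℝ) * d := by positivity
  have h2 := pos_succ ω n
  have h3 := hω n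
  have h4 := (hu_bdd (mark ω n) (mark ω (n + 1))).1
  rw [show pos ω (n + 1) - pos ω n = gap ω n by linarith, abs_of_nonneg (by linarith)]
  have : 0 ≤ lam * (pos ω n + pos ω (n + 1)) := mul_nonneg hlam0 (by linarith)
  linarith

omit hlam0 hlam1 hu_bdd hω hd in
theorem pos_one_sub (ω : Env) (i : ℕ) :
    pos ω (-(i : ℤ)) = -∑ j ∈ Finset.Ico 1 (i + 1), gap ω (-(j : ℤ)) := by
  induction i with
  | zero => simp [pos_zero]
  | succ i ih =>
    have := pos_succ ω (-((i + 1 : ℕ) : ℤ))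
    rw [show -((i + 1 : ℕ) : ℤ) + 1 = -i by push_cast; ring, ih] at this
    rw [Finset.sum_Ico_succ_top (by omega)]
    linarith

/-- The ratio of the conductances of the edges `(-i - 1, -i)` and `(0, 1)`. -/
noncomputable def edgeRatio (u : ℝ → ℝ → ℝ) (lam : ℝ) (ω : Env) (i : ℕ) : ℝ :=
  conductance u lam ω (-i) (-i + 1) / conductance u lam ω 0 1

/-- The terms of the series in `meanSeries`. -/
noncomputable def seriesTerm (lam : ℝ) (ω : Env) (i : ℕ) : ℝ :=
  Real.exp ((1 - lam) * gap ω 0 - (1 + lam) * gap ω (-(i : ℤ))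
      - 2 * lam * ∑ j ∈ Finset.Ico 1 i, gap ω (-(j : ℤ)))

omit hlam0 hlam1 hu_bdd hd in
theorem edgeRatio_succ_eq (hd : 0 < d) (i : ℕ) : edgeRatio u lam ω (i + 1)
    = Real.exp (u (mark ω (-((i + 1 : ℕ) : ℤ))) (mark ω (-((i + 1 : ℕ) : ℤ) + 1))
      - u (mark ω 0) (mark ω 1)) * seriesTerm lam ω (i + 1) := by
  rw [edgeRatio, conductance, conductance, if_neg (by omega), if_neg (by omega), seriesTerm,
    ← Real.exp_sub, ← Real.exp_add]
  congr 1
  have h1 := pos_succ ω (-((i + 1 : ℕ) : ℤ))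
  have h2 := pos_one_sub ω i
  have h3 := pos_succ ω 0
  have h4 := hω (-((i + 1 : ℕ) : ℤ))
  have h5 := hω 0
  have h6 : -((i + 1 : ℕ) : ℤ) + 1 = -i := by push_cast; ring
  rw [pos_zero, zero_add, zero_add] at h3
  rw [h6] at h1 ⊢
  rw [pos_zero, h3, abs_of_nonneg (by linarith), abs_of_nonneg (by linarith)]
  have h7 : pos ω (-((i + 1 : ℕ) : ℤ)) = pos ω (-i) - gap ω (-((i + 1 : ℕ) : ℤ)) := by linarith
  rw [h7, h2]
  ring

omit hlam0 hlam1 hd in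
theorem edgeRatio_bounds (hd : 0 < d) (i : ℕ) :
    Real.exp (-(umax - umin)) * seriesTerm lam ω (i + 1) ≤ edgeRatio u lam ω (i + 1) ∧
    edgeRatio u lam ω (i + 1) ≤ Real.exp (umax - umin) * seriesTerm lam ω (i + 1) := by
  rw [edgeRatio_succ_eq hω hd]
  have h1 := hu_bdd (mark ω (-((i + 1 : ℕ) : ℤ))) (mark ω (-((i + 1 : ℕ) : ℤ) + 1))
  have h2 := hu_bdd (mark ω 0) (mark ω 1)
  have h3 : 0 ≤ seriesTerm lam ω (i + 1) := (Real.exp_pos _).le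
  exact ⟨mul_le_mul_of_nonneg_right (Real.exp_le_exp.2 (by linarith)) h3,
    mul_le_mul_of_nonneg_right (Real.exp_le_exp.2 (by linarith)) h3⟩

/-- Drop the site `0` and keep at each other site only the conductance of the edge to its right. -/
theorem le_rightTime :
    ENNReal.ofReal (Real.exp (-(umax - umin))) * ∑' i : ℕ, ENNReal.ofReal (seriesTerm lam ω (i + 1))
      ≤ rightTime u lam ω := by
  rw [← ENNReal.tsum_mul_left, rightTime]
  refine le_trans ?_ (ENNReal.tsum_comp_le_tsum_of_injective (f := fun i : ℕ => i + 1)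
    (fun a b h => by simpa using h) _)
  refine ENNReal.tsum_le_tsum fun i => ?_
  rw [← ENNReal.ofReal_mul (Real.exp_pos _).le]
  refine ENNReal.ofReal_le_ofReal ((edgeRatio_bounds hu_bdd hω hd i).1.trans ?_)
  exact div_le_div_of_nonneg_right
    (conductance_le_totalConductance hu_bdd hlam1 hd hω hlam0 _ _) (conductance_nonneg _ _ _ _ _)

/-- Each total conductance is at most a constant times the sum of its two adjacent edges, so each
edge is counted at most twice. The edge from `0` to `1` has ratio one and gives the summand `1`. -/
theorem rightTime_le (hu_symm : ∀ a b : ℝ, u a b = u b a) :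
    rightTime u lam ω ≤ ENNReal.ofReal (comparisonConst umin umax lam d) * (2 * (1
      + ENNReal.ofReal (Real.exp (umax - umin))
        * ∑' i : ℕ, ENNReal.ofReal (seriesTerm lam ω (i + 1)))) := by
  have hr : ∀ i, 0 ≤ edgeRatio u lam ω i := fun i =>
    div_nonneg (conductance_nonneg _ _ _ _ _) (conductance_nonneg _ _ _ _ _)
  have h01 : conductance u lam ω 0 1 ≠ 0 := (conductance_pos (by omega)).ne'
  have hK : 0 ≤ comparisonConst umin umax lam d := by
    have hr : Real.exp (-((1 - lam) * d)) < 1 := by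
      rw [Real.exp_lt_one_iff]
      have : 0 < (1 - lam) * d := mul_pos (sub_pos.2 hlam1) hd
      linarith
    exact mul_nonneg (Real.exp_pos _).le (inv_nonneg.2 (by linarith))
  have h1 : ∑' i : ℕ, ENNReal.ofReal (edgeRatio u lam ω i)
      ≤ 1 + ENNReal.ofReal (Real.exp (umax - umin))
        * ∑' i : ℕ, ENNReal.ofReal (seriesTerm lam ω (i + 1)) := by
    rw [tsum_eq_zero_add' ENNReal.summable, ← ENNReal.tsum_mul_left]
    refine add_le_add ?_ (ENNReal.tsum_le_tsum fun i => ?_)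
    · simp [edgeRatio, div_self h01]
    · rw [← ENNReal.ofReal_mul (Real.exp_pos _).le]
      exact ENNReal.ofReal_le_ofReal (edgeRatio_bounds hu_bdd hω hd i).2
  have h2 : ∑' i : ℕ, ENNReal.ofReal (edgeRatio u lam ω (i + 1))
      ≤ ∑' i : ℕ, ENNReal.ofReal (edgeRatio u lam ω i) :=
    ENNReal.tsum_comp_le_tsum_of_injective (f := fun i : ℕ => i + 1)
      (fun a b h => by simpa using h) fun i => ENNReal.ofReal (edgeRatio u lam ω i)
  calc rightTime u lam ω
      ≤ ∑' i : ℕ, ENNReal.ofReal (comparisonConst umin umax lam d)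
        * (ENNReal.ofReal (edgeRatio u lam ω i) + ENNReal.ofReal (edgeRatio u lam ω (i + 1))) := by
        refine ENNReal.tsum_le_tsum fun i => ?_
        rw [← ENNReal.ofReal_add (hr _) (hr _), ← ENNReal.ofReal_mul hK]
        refine ENNReal.ofReal_le_ofReal ?_
        rw [edgeRatio, edgeRatio, ← add_div, ← mul_div_assoc]
        refine div_le_div_of_nonneg_right ?_ (conductance_nonneg _ _ _ _ _)
        refine (totalConductance_le hu_bdd hlam1 hd hω hlam0 _).trans_eq ?_
        rw [conductance_symm hu_symm (-((i + 1 : ℕ) : ℤ)),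
          show -((i + 1 : ℕ) : ℤ) = -i - 1 by push_cast; ring, sub_add_cancel]
    _ = ENNReal.ofReal (comparisonConst umin umax lam d)
        * (∑' i : ℕ, ENNReal.ofReal (edgeRatio u lam ω i)
          + ∑' i : ℕ, ENNReal.ofReal (edgeRatio u lam ω (i + 1))) := by
        rw [ENNReal.tsum_mul_left, ENNReal.tsum_add]
    _ ≤ _ := by
        rw [two_mul]
        gcongr
        exact h2.trans h1

end GoodEnvironments

/-! ### Finiteness of the mean crossing times. -/

section MeanSeries

variable {P : Measure Env} (hP : IsEnvLaw P) {u : ℝ → ℝ → ℝ}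

theorem measurable_seriesTerm (lam : ℝ) (i : ℕ) : Measurable fun ω => seriesTerm lam ω i :=
  ((((measurable_gap 0).const_mul _).sub ((measurable_gap _).const_mul _)).sub
    ((Finset.measurable_sum _ fun _ _ => measurable_gap _).const_mul _)).exp

theorem meanSeries_eq (P : Measure Env) (lam : ℝ) :
    meanSeries P lam = ∫⁻ ω, ∑' i : ℕ, ENNReal.ofReal (seriesTerm lam ω (i + 1)) ∂P := by
  let e : ℕ ≃ {i : ℕ // 1 ≤ i} :=
    { toFun := fun n => ⟨n + 1, by omega⟩
      invFun := fun i => i - 1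
      left_inv := fun n => by simp
      right_inv := fun i => Subtype.ext (by have := i.2; simp; omega) }
  refine lintegral_congr fun ω => ?_
  exact (e.tsum_eq fun i : {i : ℕ // 1 ≤ i} => ENNReal.ofReal (seriesTerm lam ω i)).symm

include hP

theorem lintegral_rightTime_lt_top_iff (hu_symm : ∀ a b : ℝ, u a b = u b a)
    (hu_bdd : ∃ umin umax : ℝ, ∀ a b : ℝ, umin ≤ u a b ∧ u a b ≤ umax)
    {lam : ℝ} (hlam0 : 0 ≤ lam) (hlam1 : lam < 1) :
    ∫⁻ ω, rightTime u lam ω ∂P < ∞ ↔ meanSeries P lam < ∞ := by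
  have := hP.isProbabilityMeasure
  obtain ⟨umin, umax, hu⟩ := hu_bdd
  obtain ⟨d, hd, hgap⟩ := hP.exists_ae_le_gap
  have hm : Measurable fun ω => ∑' i : ℕ, ENNReal.ofReal (seriesTerm lam ω (i + 1)) :=
    Measurable.tsum fun i => (measurable_seriesTerm lam (i + 1)).ennreal_ofReal
  rw [meanSeries_eq]
  constructor
  · intro h
    have h1 := lintegral_mono_ae (hgap.mono fun ω hω => le_rightTime hu hlam1 hd hω hlam0)
    rw [lintegral_const_mul _ hm] at h1
    have h2 := h1.trans_lt h
    by_contra hc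
    rw [not_lt, top_le_iff] at hc
    rw [hc, ENNReal.mul_top (by simp [Real.exp_pos])] at h2
    exact lt_irrefl _ h2
  · intro h
    refine (lintegral_mono_ae (hgap.mono fun ω hω =>
      rightTime_le hu hlam1 hd hω hlam0 hu_symm)).trans_lt ?_
    rw [lintegral_const_mul _ (((hm.const_mul _).const_add 1).const_mul 2),
      lintegral_const_mul _ ((hm.const_mul _).const_add 1), lintegral_add_left measurable_const,
      lintegral_const_mul _ hm]
    refine ENNReal.mul_lt_top ENNReal.ofReal_lt_top (ENNReal.mul_lt_top (by simp)
      (ENNReal.add_lt_top.2 ⟨by simp, ENNReal.mul_lt_top ENNReal.ofReal_lt_top h⟩))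

/-- `leftTime` is even infinite almost surely: the total conductance at `n ≥ 0` is at least a
constant times `exp (-gap ω n)`, and by Birkhoff's theorem the sums of these grow linearly. -/
theorem lintegral_leftTime_eq_top
    (hu_bdd : ∃ umin umax : ℝ, ∀ a b : ℝ, umin ≤ u a b ∧ u a b ≤ umax)
    {lam : ℝ} (hlam0 : 0 ≤ lam) (hlam1 : lam < 1) : ∫⁻ ω, leftTime u lam ω ∂P = ∞ := by
  have := hP.isProbabilityMeasure
  obtain ⟨umin, umax, hu⟩ := hu_bdd
  obtain ⟨d, hd, hgap⟩ := hP.exists_ae_le_gap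
  have hfm : Measurable fun ω : Env => Real.exp (-gap ω 0) := (measurable_gap 0).neg.exp
  have hfi : Integrable (fun ω : Env => Real.exp (-gap ω 0)) P := by
    refine Integrable.of_bound hfm.aestronglyMeasurable 1 (ae_of_all _ fun ω => ?_)
    rw [Real.norm_eq_abs, abs_of_pos (Real.exp_pos _), Real.exp_le_one_iff]
    have : 0 < gap ω 0 := (ω 0).1.2
    linarith
  have hpos : 0 < ∫ ω, Real.exp (-gap ω 0) ∂P := integral_exp_pos hfi
  suffices h : ∀ᵐ ω ∂P, leftTime u lam ω = ∞ by
    rw [lintegral_congr_ae h]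
    simp
  filter_upwards [hgap, ae_abs_birkhoffSum_sub_le hP.ergodic hfm hfi] with ω hω hB
  obtain ⟨C, hC⟩ := hB ((∫ ω, Real.exp (-gap ω 0) ∂P) / 2) (half_pos hpos)
  set m := ∫ ω, Real.exp (-gap ω 0) ∂P
  by_contra hfin
  set c := conductance u lam ω 0 (-1)
  have hc : 0 < c := conductance_pos (by omega)
  have key : ∀ n : ℕ, Real.exp umin / c * birkhoffSum (shift 1) (fun ω => Real.exp (-gap ω 0)) n ω
      ≤ (leftTime u lam ω).toReal := by
    intro n
    refine (ENNReal.ofReal_le_iff_le_toReal hfin).1 ?_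
    rw [birkhoffSum, Finset.mul_sum, ENNReal.ofReal_sum_of_nonneg fun _ _ => by positivity]
    refine (Finset.sum_le_sum fun j _ => ?_).trans (ENNReal.sum_le_tsum (Finset.range n))
    refine ENNReal.ofReal_le_ofReal ?_
    rw [iterate_shift, gap_shift, zero_add, mul_one, div_mul_eq_mul_div]
    exact div_le_div_of_nonneg_right ((exp_neg_gap_le_conductance hu hd hω hlam0 j).trans
      (conductance_le_totalConductance hu hlam1 hd hω hlam0 _ _)) hc.le
  have ha : 0 < Real.exp umin / c := by positivity
  obtain ⟨n, hn⟩ := exists_nat_gt (((leftTime u lam ω).toReal / (Real.exp umin / c) + C) / (m / 2))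
  rw [div_lt_iff₀ (half_pos hpos)] at hn
  have h1 := (abs_le.1 (hC n)).1
  have h2 := key n
  rw [mul_comm, ← le_div_iff₀ ha] at h2
  linarith

end MeanSeries

/-! ### The invariant density and its electrical interpretation. -/

section StationaryDensity

variable {u : ℝ → ℝ → ℝ} {lam : ℝ}

/-- The density with respect to `P` of the stationary measure of the environment seen from the
walker: the mean number of visits to the origin. -/
noncomputable def visitDensity (u : ℝ → ℝ → ℝ) (lam : ℝ) (ω : Env) : ℝ≥0∞ :=
  ∑' j : ℕ, ENNReal.ofReal (totalConductance u lam ω 0 / conductance u lam ω j (j + 1))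

/-- The resistance between the site `k` and infinity. -/
noncomputable def resistance (u : ℝ → ℝ → ℝ) (lam : ℝ) (ω : Env) (k : ℤ) : ℝ≥0∞ :=
  ∑' j : ℕ, ENNReal.ofReal (conductance u lam ω (k + j) (k + j + 1))⁻¹

theorem totalConductance_div_conductance_shift (u : ℝ → ℝ → ℝ) (lam : ℝ) (l : ℤ) (ω : Env)
    (i j k : ℤ) : totalConductance u lam (shift l ω) i / conductance u lam (shift l ω) j k
      = totalConductance u lam ω (i + l) / conductance u lam ω (j + l) (k + l) := by
  rw [totalConductance_shift, conductance_shift, mul_div_mul_left _ _ (Real.exp_pos _).ne']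

theorem resistance_eq_add (u : ℝ → ℝ → ℝ) (lam : ℝ) (ω : Env) (k : ℤ) :
    resistance u lam ω k
      = ENNReal.ofReal (conductance u lam ω k (k + 1))⁻¹ + resistance u lam ω (k + 1) := by
  rw [resistance, resistance, tsum_eq_zero_add' ENNReal.summable]
  congr 1
  · simp
  · refine tsum_congr fun j => ?_
    rw [show k + ((j + 1 : ℕ) : ℤ) = k + 1 + j by push_cast; ring]

/-- A potential equal to the resistance to `+∞` drives a unit current through each edge. The
additive form stays meaningful when the resistance is infinite. -/
theorem conductance_mul_resistance (u : ℝ → ℝ → ℝ) (lam : ℝ) (ω : Env) (k : ℤ) :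
    ENNReal.ofReal (conductance u lam ω k (k + 1)) * resistance u lam ω k
      = 1 + ENNReal.ofReal (conductance u lam ω k (k + 1)) * resistance u lam ω (k + 1) := by
  have h : 0 < conductance u lam ω k (k + 1) := conductance_pos (by omega)
  rw [resistance_eq_add, mul_add, ← ENNReal.ofReal_mul h.le, mul_inv_cancel₀ h.ne',
    ENNReal.ofReal_one]

variable {ω : Env} (hpos : ∀ k, 0 < totalConductance u lam ω k)
include hpos

/-- Along an orbit the density is the reversible weight times the potential `resistance`, which
reduces stationarity to conservation of current. -/
theorem visitDensity_shift (k : ℤ) : visitDensity u lam (shift k ω)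
      = ENNReal.ofReal (totalConductance u lam ω k) * resistance u lam ω k := by
  rw [visitDensity, resistance, ← ENNReal.tsum_mul_left]
  refine tsum_congr fun j => ?_
  rw [totalConductance_div_conductance_shift, ← ENNReal.ofReal_mul (hpos k).le, zero_add,
    ← div_eq_mul_inv, add_comm (j : ℤ) k, add_right_comm, add_comm (j : ℤ) k]

theorem visitDensity_shift_mul_jump (k j : ℤ) : visitDensity u lam (shift k ω)
      * ENNReal.ofReal (fullJumpProb u lam (shift k ω) 0 j)
      = ENNReal.ofReal (conductance u lam ω k (j + k)) * resistance u lam ω k := by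
  rw [visitDensity_shift hpos, fullJumpProb_shift, zero_add, mul_right_comm,
    ← ENNReal.ofReal_mul (hpos k).le, fullJumpProb_eq, mul_div_cancel₀ _ (hpos k).ne']

theorem visitDensity_mul_right : visitDensity u lam ω * ENNReal.ofReal (fullJumpProb u lam ω 0 1)
      = ENNReal.ofReal (conductance u lam ω 0 1) * resistance u lam ω 0 := by
  have h := visitDensity_shift_mul_jump hpos 0 1
  rwa [shift_zero, add_zero] at h

theorem visitDensity_mul_right_eq_add (hu_symm : ∀ a b : ℝ, u a b = u b a) :
    visitDensity u lam ω * ENNReal.ofReal (fullJumpProb u lam ω 0 1)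
      = 1 + visitDensity u lam (shift 1 ω)
        * ENNReal.ofReal (fullJumpProb u lam (shift 1 ω) 0 (-1)) := by
  have h2 := conductance_mul_resistance u lam ω 0
  rw [zero_add] at h2
  rw [visitDensity_mul_right hpos, visitDensity_shift_mul_jump hpos 1 (-1), h2, neg_add_cancel,
    conductance_symm hu_symm]

/-- Inflow from the left exceeds the outflow to the left by one, and inflow from the right falls
short of the outflow to the right by one. The unit currents cancel, leaving the density times total
probability one; no subtraction is used, so infinite values are allowed. -/
theorem visitDensity_balance (hu_symm : ∀ a b : ℝ, u a b = u b a) :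
    visitDensity u lam (shift 1 ω) * ENNReal.ofReal (fullJumpProb u lam (shift 1 ω) 0 (-1))
      + (visitDensity u lam ω * ENNReal.ofReal
          (1 - fullJumpProb u lam ω 0 1 - fullJumpProb u lam ω 0 (-1))
      + visitDensity u lam (shift (-1) ω)
        * ENNReal.ofReal (fullJumpProb u lam (shift (-1) ω) 0 1)) = visitDensity u lam ω := by
  have h1 := visitDensity_mul_right_eq_add hpos hu_symm
  have h2 : visitDensity u lam (shift (-1) ω)
        * ENNReal.ofReal (fullJumpProb u lam (shift (-1) ω) 0 1)
      = 1 + visitDensity u lam ω * ENNReal.ofReal (fullJumpProb u lam ω 0 (-1)) := by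
    have h3 := conductance_mul_resistance u lam ω (-1)
    have h4 := visitDensity_shift_mul_jump hpos 0 (-1)
    rw [neg_add_cancel] at h3
    rw [shift_zero, add_zero, conductance_symm hu_symm] at h4
    rw [visitDensity_shift_mul_jump hpos, h4, add_neg_cancel, h3]
  have hp := fullJumpProb_nonneg u lam ω 0 1
  have hq := fullJumpProb_nonneg u lam ω 0 (-1)
  have hr : 0 ≤ 1 - fullJumpProb u lam ω 0 1 - fullJumpProb u lam ω 0 (-1) := by
    have := fullJumpProb_add_le_one u lam ω 0
    rw [zero_add, zero_sub] at this
    linarith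
  rw [h2, add_comm _ (1 + _), ← add_assoc, ← add_assoc, add_comm _ 1, ← h1, ← mul_add, ← mul_add,
    ← ENNReal.ofReal_add hp hq, ← ENNReal.ofReal_add (add_nonneg hp hq) hr]
  rw [show fullJumpProb u lam ω 0 1 + fullJumpProb u lam ω 0 (-1)
    + (1 - fullJumpProb u lam ω 0 1 - fullJumpProb u lam ω 0 (-1)) = 1 by ring,
    ENNReal.ofReal_one, mul_one]

theorem visitDensity_ne_zero : visitDensity u lam ω ≠ 0 := by
  intro h
  have h1 := (ENNReal.tsum_eq_zero.1 h) 0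
  rw [ENNReal.ofReal_eq_zero] at h1
  have h2 : 0 < conductance u lam ω 0 1 := conductance_pos (by omega)
  exact absurd h1 (not_le.2 (div_pos (hpos 0) h2))

end StationaryDensity

/-! ### The invariant measure for the pair of environment and trajectory. -/

section StationaryMeasure

variable {P : Measure Env} {u : ℝ → ℝ → ℝ} (hu : Measurable (Function.uncurry u)) (lam : ℝ)
include hu

theorem measurable_visitDensity : Measurable (visitDensity u lam) :=
  Measurable.tsum fun j => ((measurable_totalConductance hu lam 0).div
    (measurable_conductance hu lam j (j + 1))).ennreal_ofReal

/-- The quenched law of the walk as a kernel. -/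
noncomputable def walkKernel : Kernel Env (ℕ → ℤ) where
  toFun ω := walkLaw u lam 1 ω 0
  measurable' := measurable_walkLaw hu lam 1 0

instance isMarkovKernel_walkKernel : IsMarkovKernel (walkKernel hu lam) :=
  ⟨fun ω => isProbabilityMeasure_walkLaw u lam 1 ω 0⟩

/-- Stationarity of `P` under the shift by `j` matches the two series term by term. -/
theorem lintegral_visitDensity (hP : IsEnvLaw P) :
    ∫⁻ ω, visitDensity u lam ω ∂P = ∫⁻ ω, rightTime u lam ω ∂P := by
  unfold visitDensity rightTime
  have hm : ∀ i j k : ℤ, Measurable fun ω => ENNReal.ofReal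
      (totalConductance u lam ω i / conductance u lam ω j k) := fun i j k =>
    ((measurable_totalConductance hu lam i).div (measurable_conductance hu lam j k)).ennreal_ofReal
  rw [lintegral_tsum fun j => (hm _ _ _).aemeasurable, lintegral_tsum fun j => (hm _ _ _).aemeasurable]
  refine tsum_congr fun j => ?_
  rw [← hP.lintegral_shift j (hm (-(j : ℤ)) 0 1)]
  simp only [totalConductance_div_conductance_shift, neg_add_cancel, zero_add]
  rw [add_comm 1 (j : ℤ)]

/-- Moving each of the three possible jumps onto the density by a shift of `P` leaves `F` at `ω`
times the left side of `visitDensity_balance`. -/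
theorem lintegral_visitDensity_mul_step (hP : IsEnvLaw P) (hu_symm : ∀ a b : ℝ, u a b = u b a)
    (hpos : ∀ᵐ ω ∂P, ∀ k, 0 < totalConductance u lam ω k) {F : Env → ℝ≥0∞} (hF : Measurable F) :
    ∫⁻ ω, visitDensity u lam ω * ∑' j, F (shift j ω) * stepPMF u lam 1 ω 0 j ∂P
      = ∫⁻ ω, visitDensity u lam ω * F ω ∂P := by
  have hL := measurable_visitDensity hu lam
  have hp := (measurable_fullJumpProb hu lam 0 1).ennreal_ofReal
  have hq := (measurable_fullJumpProb hu lam 0 (-1)).ennreal_ofReal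
  have hr : Measurable fun ω : Env => ENNReal.ofReal
      (1 - fullJumpProb u lam ω 0 1 - fullJumpProb u lam ω 0 (-1)) :=
    ((measurable_const.sub (measurable_fullJumpProb hu lam 0 1)).sub
      (measurable_fullJumpProb hu lam 0 (-1))).ennreal_ofReal
  have e1 : ∀ ω, visitDensity u lam ω * ∑' j, F (shift j ω) * stepPMF u lam 1 ω 0 j
      = F (shift (-1) ω)
          * (visitDensity u lam ω * ENNReal.ofReal (fullJumpProb u lam ω 0 (-1)))
        + (F ω * (visitDensity u lam ω * ENNReal.ofReal
            (1 - fullJumpProb u lam ω 0 1 - fullJumpProb u lam ω 0 (-1)))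
        + F (shift 1 ω)
          * (visitDensity u lam ω * ENNReal.ofReal (fullJumpProb u lam ω 0 1))) := by
    intro ω
    rw [tsum_mul_stepPMF_one u lam ω (fun j => F (shift j ω)) 0, zero_add, zero_sub, shift_zero]
    ring
  have hq' : Measurable fun ω => F ω * (visitDensity u lam (shift 1 ω)
      * ENNReal.ofReal (fullJumpProb u lam (shift 1 ω) 0 (-1))) :=
    hF.mul ((hL.mul hq).comp (measurable_shift 1))
  have hp' : Measurable fun ω => F ω * (visitDensity u lam (shift (-1) ω)
      * ENNReal.ofReal (fullJumpProb u lam (shift (-1) ω) 0 1)) :=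
    hF.mul ((hL.mul hp).comp (measurable_shift (-1)))
  have hr' : Measurable fun ω => F ω * (visitDensity u lam ω * ENNReal.ofReal
      (1 - fullJumpProb u lam ω 0 1 - fullJumpProb u lam ω 0 (-1))) := hF.mul (hL.mul hr)
  have hq'' : Measurable fun ω => F (shift (-1) ω)
      * (visitDensity u lam ω * ENNReal.ofReal (fullJumpProb u lam ω 0 (-1))) :=
    (hF.comp (measurable_shift (-1))).mul (hL.mul hq)
  have s1 := hP.lintegral_shift (-1) hq'
  have s2 := hP.lintegral_shift 1 hp'
  simp only [shift_shift, add_neg_cancel, neg_add_cancel, shift_zero] at s1 s2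
  simp_rw [e1]
  rw [lintegral_add_left hq'', lintegral_add_left hr', s1, s2, ← lintegral_add_left hr',
    ← lintegral_add_left hq']
  refine lintegral_congr_ae ?_
  filter_upwards [hpos] with ω hω
  rw [← mul_add, ← mul_add, visitDensity_balance hω hu_symm, mul_comm]

/-- The joint stationary measure of the environment seen from the walker and its trajectory. -/
noncomputable def stationaryMeasure (P : Measure Env) : Measure (Env × (ℕ → ℤ)) :=
  P.withDensity (visitDensity u lam) ⊗ₘ walkKernel hu lam

omit hu in
/-- One step of the walk, seen from the walker. -/
def stepShift (z : Env × (ℕ → ℤ)) : Env × (ℕ → ℤ) :=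
  (shift (z.2 1) z.1, fun k => z.2 (k + 1) - z.2 1)

omit hu in
theorem measurable_stepShift : Measurable stepShift := by
  have hc : ∀ k, Measurable fun z : Env × (ℕ → ℤ) => z.2 k := fun k =>
    (measurable_pi_apply k).comp measurable_snd
  have h1 : Measurable fun z : ℤ × Env => shift z.1 z.2 :=
    measurable_from_prod_countable_right fun l => measurable_shift l
  have h2 : Measurable fun z : ℤ × ℤ => z.1 - z.2 := Measurable.of_discrete
  exact (h1.comp ((hc 1).prodMk measurable_fst)).prodMk
    (measurable_pi_lambda _ fun k => h2.comp ((hc (k + 1)).prodMk (hc 1)))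

variable (hP : IsEnvLaw P)
include hP

theorem lintegral_stationaryMeasure {f : Env × (ℕ → ℤ) → ℝ≥0∞} (hf : Measurable f) :
    ∫⁻ z, f z ∂stationaryMeasure hu lam P
      = ∫⁻ ω, visitDensity u lam ω * ∫⁻ X, f (ω, X) ∂walkLaw u lam 1 ω 0 ∂P := by
  have := hP.isProbabilityMeasure
  rw [stationaryMeasure, Measure.lintegral_compProd hf, lintegral_withDensity_eq_lintegral_mul _
    (measurable_visitDensity hu lam) hf.lintegral_kernel_prod_right']
  rfl

/-- Given the first jump, the rest of the trajectory is a walk in the shifted environment, so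
invariance reduces to that of the density on environments. -/
theorem measurePreserving_stepShift (hu_symm : ∀ a b : ℝ, u a b = u b a)
    (hpos : ∀ᵐ ω ∂P, ∀ k, 0 < totalConductance u lam ω k) :
    MeasurePreserving stepShift (stationaryMeasure hu lam P) (stationaryMeasure hu lam P) := by
  refine ⟨measurable_stepShift, Measure.ext_of_lintegral _ fun f hf => ?_⟩
  rw [lintegral_map hf measurable_stepShift, lintegral_stationaryMeasure hu lam hP hf]
  refine (lintegral_stationaryMeasure hu lam hP (hf.comp measurable_stepShift)).trans ?_
  have hF : Measurable fun ω => ∫⁻ X, f (ω, X) ∂walkLaw u lam 1 ω 0 :=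
    hf.lintegral_kernel_prod_right' (κ := walkKernel hu lam)
  rw [← lintegral_visitDensity_mul_step hu lam hP hu_symm hpos hF]
  refine lintegral_congr fun ω => ?_
  congr 1
  refine (lintegral_walkLaw_first_step u lam 1 ω (stepPMF_shift u lam 1 ω)
    (f := fun j X => f (shift j ω, X)) fun j => hf.comp measurable_prodMk_left).trans ?_
  exact tsum_congr fun j => mul_comm _ _

omit hu hP in
theorem lintegral_first_step (ω : Env) (f : ℤ → ℝ≥0∞) :
    ∫⁻ X, f (X 1) ∂walkLaw u lam 1 ω 0 = ∑' j, f j * stepPMF u lam 1 ω 0 j := by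
  refine (lintegral_walkLaw_first_step u lam 1 ω (stepPMF_shift u lam 1 ω)
    (f := fun j _ => f j) fun j => measurable_const).trans ?_
  refine tsum_congr fun j => ?_
  rw [lintegral_const, measure_univ, mul_one, mul_comm]

theorem stationaryMeasure_univ :
    stationaryMeasure hu lam P Set.univ = ∫⁻ ω, rightTime u lam ω ∂P := by
  have := hP.isProbabilityMeasure
  rw [stationaryMeasure, Measure.compProd_apply_univ, withDensity_apply _ MeasurableSet.univ,
    setLIntegral_univ, lintegral_visitDensity hu lam hP]

/-- The mean displacement in one step under the (not normalized) stationary measure is one. -/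
theorem integral_first_step (hu_symm : ∀ a b : ℝ, u a b = u b a)
    (hpos : ∀ᵐ ω ∂P, ∀ k, 0 < totalConductance u lam ω k)
    (hfin : ∫⁻ ω, rightTime u lam ω ∂P < ∞) :
    Integrable (fun z => (z.2 1 : ℝ)) (stationaryMeasure hu lam P) ∧
    ∫ z, (z.2 1 : ℝ) ∂stationaryMeasure hu lam P = 1 := by
  have := hP.isProbabilityMeasure
  have hL := measurable_visitDensity hu lam
  have hq := (measurable_fullJumpProb hu lam 0 (-1)).ennreal_ofReal
  have hm : Measurable fun z : Env × (ℕ → ℤ) => (z.2 1 : ℝ) :=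
    (Measurable.of_discrete (f := fun k : ℤ => (k : ℝ))).comp
      ((measurable_pi_apply 1).comp measurable_snd)
  have hn : ENNReal.ofReal (-1) = 0 := ENNReal.ofReal_of_nonpos (by norm_num)
  have h1 : ∫⁻ z, ENNReal.ofReal (z.2 1 : ℝ) ∂stationaryMeasure hu lam P
      = ∫⁻ ω, visitDensity u lam ω * ENNReal.ofReal (fullJumpProb u lam ω 0 1) ∂P := by
    rw [lintegral_stationaryMeasure hu lam hP hm.ennreal_ofReal]
    refine lintegral_congr fun ω => ?_
    rw [lintegral_first_step lam ω fun k => ENNReal.ofReal (k : ℝ), tsum_mul_stepPMF_one]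
    simp [hn]
  have h2 : ∫⁻ z, ENNReal.ofReal (-(z.2 1 : ℝ)) ∂stationaryMeasure hu lam P
      = ∫⁻ ω, visitDensity u lam ω * ENNReal.ofReal (fullJumpProb u lam ω 0 (-1)) ∂P := by
    refine (lintegral_stationaryMeasure hu lam hP hm.neg.ennreal_ofReal).trans ?_
    refine lintegral_congr fun ω => ?_
    simp only [Pi.neg_apply]
    rw [lintegral_first_step lam ω fun k => ENNReal.ofReal (-(k : ℝ)), tsum_mul_stepPMF_one]
    simp [hn]
  -- The unit current and the stationarity of `P` make the rightward mass exceed the leftward mass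
  -- by exactly one.
  have h3 : ∫⁻ ω, visitDensity u lam ω * ENNReal.ofReal (fullJumpProb u lam ω 0 1) ∂P
      = 1 + ∫⁻ ω, visitDensity u lam ω * ENNReal.ofReal (fullJumpProb u lam ω 0 (-1)) ∂P := by
    rw [lintegral_congr_ae (hpos.mono fun ω hω => visitDensity_mul_right_eq_add hω hu_symm),
      lintegral_add_left measurable_const, lintegral_const, measure_univ, mul_one]
    exact congrArg _ (hP.lintegral_shift 1 (hL.mul hq))
  have h4 : ∫⁻ ω, visitDensity u lam ω * ENNReal.ofReal (fullJumpProb u lam ω 0 (-1)) ∂P ≠ ∞ := by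
    refine ((lintegral_mono fun ω => ?_).trans_lt
      ((lintegral_visitDensity hu lam hP).trans_lt hfin)).ne
    refine mul_le_of_le_one_right' (ENNReal.ofReal_le_one.2 ?_)
    have := fullJumpProb_add_le_one u lam ω 0
    have := fullJumpProb_nonneg u lam ω 0 1
    simp only [zero_add, zero_sub] at *
    linarith
  have hi : Integrable (fun z => (z.2 1 : ℝ)) (stationaryMeasure hu lam P) := by
    refine ⟨hm.aestronglyMeasurable, ?_⟩
    rw [hasFiniteIntegral_iff_norm]
    have h5 : ∀ x : ℝ, ENNReal.ofReal ‖x‖ = ENNReal.ofReal x + ENNReal.ofReal (-x) := by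
      intro x
      rcases le_total 0 x with h | h
      · rw [Real.norm_of_nonneg h, ENNReal.ofReal_of_nonpos (neg_nonpos.2 h), add_zero]
      · rw [Real.norm_of_nonpos h, ENNReal.ofReal_of_nonpos h, zero_add]
    simp_rw [h5]
    rw [lintegral_add_left hm.ennreal_ofReal, h1, h2, h3]
    exact ENNReal.add_lt_top.2 ⟨ENNReal.add_lt_top.2 ⟨ENNReal.one_lt_top, h4.lt_top⟩, h4.lt_top⟩
  refine ⟨hi, ?_⟩
  rw [integral_eq_lintegral_pos_part_sub_lintegral_neg_part hi, h1, h2, h3,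
    ENNReal.toReal_add ENNReal.one_ne_top h4]
  simp

omit hu hP in
theorem iterate_stepShift_snd {z : Env × (ℕ → ℤ)} (hz : z.2 0 = 0) (k j : ℕ) :
    (stepShift^[k] z).2 j = z.2 (j + k) - z.2 k := by
  induction k generalizing j with
  | zero => simp [hz]
  | succ k ih =>
    rw [Function.iterate_succ_apply']
    change (stepShift^[k] z).2 (j + 1) - (stepShift^[k] z).2 1 = _
    rw [ih, ih, show j + 1 + k = j + (k + 1) by omega, add_comm 1 k]
    ring

omit hu hP in
-- The increments telescope; this identifies the growth of the walk with an ergodic average.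
theorem birkhoffSum_stepShift {z : Env × (ℕ → ℤ)} (hz : z.2 0 = 0) (n : ℕ) :
    birkhoffSum stepShift (fun z => (z.2 1 : ℝ)) n z = z.2 n := by
  induction n with
  | zero => simp [hz]
  | succ n ih =>
    rw [birkhoffSum_succ, ih, iterate_stepShift_snd hz, add_comm 1 n]
    push_cast
    ring

end StationaryMeasure

/-! ### Law of large numbers in the two regimes. -/

section Speed

variable {α : Type*} [MeasurableSpace α]

/-- Countable quantifiers serve both measurability and the exchange with almost sure statements. -/
theorem forall_pos_exists_le_iff_nat {Y : ℕ → ℝ} {v : ℝ} :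
    (∀ ε : ℝ, 0 < ε → ∃ C : ℝ, ∀ n : ℕ, Y n ≤ (v + ε) * n + C) ↔
      ∀ k : ℕ, ∃ K : ℕ, ∀ n : ℕ, Y n ≤ (v + 1 / ((k : ℝ) + 1)) * n + K := by
  constructor
  · intro h k
    obtain ⟨C, hC⟩ := h _ (Nat.one_div_pos_of_nat (n := k))
    obtain ⟨K, hK⟩ := exists_nat_ge C
    exact ⟨K, fun n => (hC n).trans (by linarith)⟩
  · intro h ε hε
    obtain ⟨k, hk⟩ := exists_nat_one_div_lt hε
    obtain ⟨K, hK⟩ := h k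
    refine ⟨K, fun n => (hK n).trans ?_⟩
    gcongr

theorem measurableSet_forall_pos_exists_le {Y : ℕ → α → ℝ} (hY : ∀ n, Measurable (Y n)) (v : ℝ) :
    MeasurableSet {x | ∀ ε : ℝ, 0 < ε → ∃ C : ℝ, ∀ n : ℕ, Y n x ≤ (v + ε) * n + C} := by
  have : {x | ∀ ε : ℝ, 0 < ε → ∃ C : ℝ, ∀ n : ℕ, Y n x ≤ (v + ε) * n + C}
      = ⋂ k : ℕ, ⋃ K : ℕ, ⋂ n : ℕ, {x | Y n x ≤ (v + 1 / ((k : ℝ) + 1)) * n + K} := by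
    ext x
    simp only [Set.mem_ofPred_eq, Set.mem_iInter, Set.mem_iUnion]
    exact forall_pos_exists_le_iff_nat
  rw [this]
  exact MeasurableSet.iInter fun k => MeasurableSet.iUnion fun K => MeasurableSet.iInter fun n =>
    measurableSet_le (hY n) measurable_const

theorem tendsto_div_of_linear_bounds {Y : ℕ → ℝ} {v : ℝ}
    (h1 : ∀ ε : ℝ, 0 < ε → ∃ C : ℝ, ∀ n : ℕ, Y n ≤ (v + ε) * n + C)
    (h2 : ∀ ε : ℝ, 0 < ε → ∃ C : ℝ, ∀ n : ℕ, (v - ε) * n - C ≤ Y n) :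
    Tendsto (fun n : ℕ => Y n / n) atTop (𝓝 v) := by
  rw [Metric.tendsto_atTop]
  intro ε hε
  obtain ⟨C1, hC1⟩ := h1 (ε / 2) (half_pos hε)
  obtain ⟨C2, hC2⟩ := h2 (ε / 2) (half_pos hε)
  obtain ⟨N, hN⟩ := exists_nat_gt (max C1 C2 / (ε / 2))
  refine ⟨N + 1, fun n hn => ?_⟩
  have hn0 : (0 : ℝ) < n := by exact_mod_cast (by omega : 0 < n)
  have hNn : (N : ℝ) ≤ n := by exact_mod_cast (by omega : N ≤ n)
  have h3 : max C1 C2 < ε / 2 * n := by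
    have := hN.trans_le hNn
    rwa [div_lt_iff₀ (half_pos hε), mul_comm] at this
  rw [Real.dist_eq, abs_lt, lt_sub_iff_add_lt, sub_lt_iff_lt_add, lt_div_iff₀ hn0, div_lt_iff₀ hn0]
  have := hC1 n
  have := hC2 n
  have := le_max_left C1 C2
  have := le_max_right C1 C2
  constructor <;> nlinarith

/-- Passage from bounds on multiples of `Y n` to a bound on its growth rate. -/
theorem ae_ae_le_of_mul_le {β : Type*} [MeasurableSpace β] {μ : Measure α} {κ : α → Measure β}
    {Y : ℕ → β → ℝ} {v : ℝ}
    (h : ∀ ε : ℝ, 0 < ε → ∃ b : ℝ, 0 < b ∧ 1 < b * (v + ε) ∧ ∀ᵐ x ∂μ, ∀ᵐ y ∂κ x,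
      ∀ δ : ℝ, 0 < δ → ∃ C : ℝ, ∀ n : ℕ, b * Y n y ≤ (1 + δ) * n + C) :
    ∀ᵐ x ∂μ, ∀ᵐ y ∂κ x, ∀ ε : ℝ, 0 < ε → ∃ C : ℝ, ∀ n : ℕ, Y n y ≤ (v + ε) * n + C := by
  have h1 : ∀ᵐ x ∂μ, ∀ k : ℕ, ∀ᵐ y ∂κ x,
      ∃ C : ℝ, ∀ n : ℕ, Y n y ≤ (v + 1 / ((k : ℝ) + 1)) * n + C := by
    refine ae_all_iff.2 fun k => ?_
    obtain ⟨b, hb, hbv, hX⟩ := h _ (Nat.one_div_pos_of_nat (n := k))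
    filter_upwards [hX] with x hx
    filter_upwards [hx] with y hy
    -- With `δ = b (v + ε) - 1`, dividing by `b` gives slope exactly `v + ε`.
    obtain ⟨C, hC⟩ := hy _ (sub_pos.2 hbv)
    refine ⟨C / b, fun n => ?_⟩
    have h2 := hC n
    rw [← mul_le_mul_iff_right₀ hb]
    refine h2.trans_eq ?_
    field_simp
    ring
  filter_upwards [h1] with x hx
  filter_upwards [ae_all_iff.2 hx] with y hy
  refine forall_pos_exists_le_iff_nat.2 fun k => ?_
  obtain ⟨C, hC⟩ := hy k
  obtain ⟨K, hK⟩ := exists_nat_ge C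
  exact ⟨K, fun n => (hC n).trans (by linarith)⟩

variable {P : Measure Env} (hP : IsEnvLaw P) {u : ℝ → ℝ → ℝ}
  (hu : Measurable (Function.uncurry u)) (hu_symm : ∀ a b : ℝ, u a b = u b a) {lam : ℝ}
  (hpos : ∀ᵐ ω ∂P, ∀ k, 0 < totalConductance u lam ω k)
include hP hu hu_symm hpos

theorem ae_tendsto_zero_of_rightTime_eq_top (hR : ∫⁻ ω, rightTime u lam ω ∂P = ∞)
    (hL : ∫⁻ ω, leftTime u lam ω ∂P = ∞) :
    ∀ᵐ ω ∂P, ∀ᵐ X ∂walkLaw u lam 1 ω 0,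
      Tendsto (fun n : ℕ => (X n : ℝ) / (n : ℝ)) atTop (𝓝 0) := by
  -- Infinite means allow any `b`; every `b > 1 / ε` would do.
  have hb : ∀ ε : ℝ, 0 < ε → 0 < 2 / ε ∧ 1 < 2 / ε * (0 + ε) := fun ε hε =>
    ⟨by positivity, by rw [zero_add, div_mul_cancel₀ _ hε.ne']; norm_num⟩
  have h1 := ae_ae_le_of_mul_le (μ := P) (κ := fun ω => walkLaw u lam 1 ω 0)
    (Y := fun n X => (X n : ℝ)) fun ε hε => ⟨2 / ε, (hb ε hε).1, (hb ε hε).2,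
      ae_mul_walk_le hP hu lam hu_symm hpos (hb ε hε).1.le (hR ▸ ENNReal.ofReal_lt_top)⟩
  have h2 := ae_ae_le_of_mul_le (μ := P) (κ := fun ω => walkLaw u lam 1 ω 0)
    (Y := fun n X => -(X n : ℝ)) fun ε hε => ⟨2 / ε, (hb ε hε).1, (hb ε hε).2,
      ae_mul_neg_walk_le hP hu lam hu_symm hpos (hb ε hε).1.le (hL ▸ ENNReal.ofReal_lt_top)⟩
  filter_upwards [h1, h2] with ω h1 h2
  filter_upwards [h1, h2] with X h1 h2
  refine tendsto_div_of_linear_bounds h1 fun ε hε => ?_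
  obtain ⟨C, hC⟩ := h2 ε hε
  exact ⟨C, fun n => by linarith [hC n]⟩

theorem ae_tendsto_of_rightTime_lt_top (hR : ∫⁻ ω, rightTime u lam ω ∂P < ∞)
    (hR0 : 0 < (∫⁻ ω, rightTime u lam ω ∂P).toReal) :
    ∀ᵐ ω ∂P, ∀ᵐ X ∂walkLaw u lam 1 ω 0, Tendsto (fun n : ℕ => (X n : ℝ) / (n : ℝ)) atTop
      (𝓝 (∫⁻ ω, rightTime u lam ω ∂P).toReal⁻¹) := by
  have := hP.isProbabilityMeasure
  set V := (∫⁻ ω, rightTime u lam ω ∂P).toReal with hV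
  have h1 : ∀ᵐ ω ∂P, ∀ᵐ X ∂walkLaw u lam 1 ω 0, ∀ ε : ℝ, 0 < ε → ∃ C : ℝ, ∀ n : ℕ,
      (X n : ℝ) ≤ (V⁻¹ + ε) * n + C := by
    refine ae_ae_le_of_mul_le (μ := P) (κ := fun ω => walkLaw u lam 1 ω 0)
      (Y := fun n X => (X n : ℝ)) fun ε hε => ?_
    have hs : 0 < V⁻¹ + ε := by positivity
    have hsV : (V⁻¹ + ε)⁻¹ < V := inv_lt_of_inv_lt₀ hR0 (by linarith)
    obtain ⟨b, hb1, hb2⟩ := exists_between hsV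
    have hb0 : 0 < b := (inv_pos.2 hs).trans hb1
    refine ⟨b, hb0, ?_, ae_mul_walk_le hP hu lam hu_symm hpos hb0.le
      ((ENNReal.ofReal_lt_iff_lt_toReal hb0.le hR.ne).2 hb2)⟩
    rwa [inv_lt_iff_one_lt_mul₀ hs] at hb1
  set Q := stationaryMeasure hu lam P with hQ
  have hQuniv : Q Set.univ = ∫⁻ ω, rightTime u lam ω ∂P := stationaryMeasure_univ hu lam hP
  have hQfin : IsFiniteMeasure Q := ⟨hQuniv ▸ hR⟩
  have hLm := measurable_visitDensity hu lam
  obtain ⟨hint, hmean⟩ := integral_first_step hu lam hP hu_symm hpos hR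
  have hm : ∀ n, Measurable fun z : Env × (ℕ → ℤ) => (z.2 n : ℝ) := fun n =>
    (Measurable.of_discrete (f := fun k : ℤ => (k : ℝ))).comp
      ((measurable_pi_apply n).comp measurable_snd)
  have hac : P.withDensity (visitDensity u lam) ≪ P := withDensity_absolutelyContinuous _ _
  have hz : ∀ᵐ z ∂Q, z.2 0 = 0 := by
    refine Measure.ae_compProd_of_ae_ae ?_ (ae_of_all _ fun ω => ae_walkLaw_zero u lam 1 ω 0)
    exact measurable_snd (measurableSet_coord_eq 0 0)
  have hup : ∀ᵐ z ∂Q, ∀ ε : ℝ, 0 < ε → ∃ C : ℝ, ∀ n : ℕ, (z.2 n : ℝ) ≤ (V⁻¹ + ε) * n + C :=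
    Measure.ae_compProd_of_ae_ae (measurableSet_forall_pos_exists_le hm V⁻¹) (hac.ae_le h1)
  -- The mean displacement `1` equals `V⁻¹` times the mass `V`, so the almost sure upper bound
  -- already has the mean as its slope and the lower bound follows.
  have hlow := ae_le_birkhoffSum_of_ae_birkhoffSum_le
    (measurePreserving_stepShift hu lam hP hu_symm hpos) (hm 1) hint (v := V⁻¹)
    (by rw [hmean, measureReal_def, ← hQ, hQuniv, ← hV, inv_mul_cancel₀ hR0.ne'])
    (by
      filter_upwards [hup, hz] with z h hz
      simpa only [birkhoffSum_stepShift hz] using h)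
  have hlim : ∀ᵐ z ∂Q, Tendsto (fun n : ℕ => (z.2 n : ℝ) / (n : ℝ)) atTop (𝓝 V⁻¹) := by
    filter_upwards [hup, hlow, hz] with z h1 h2 hz
    simp only [birkhoffSum_stepShift hz] at h2
    exact tendsto_div_of_linear_bounds h1 h2
  -- Positivity of the density carries null sets of the invariant measure back to `P`.
  have hac' : P ≪ P.withDensity (visitDensity u lam) :=
    withDensity_absolutelyContinuous' hLm.aemeasurable
      (hpos.mono fun ω hω => visitDensity_ne_zero hω)
  have : IsFiniteMeasure (P.withDensity (visitDensity u lam)) := by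
    refine ⟨?_⟩
    rw [withDensity_apply _ MeasurableSet.univ, setLIntegral_univ, lintegral_visitDensity hu lam hP]
    exact hR
  have h2 : ∀ᵐ ω ∂P.withDensity (visitDensity u lam), ∀ᵐ X ∂walkKernel hu lam ω,
      Tendsto (fun n : ℕ => (X n : ℝ) / (n : ℝ)) atTop (𝓝 V⁻¹) :=
    Measure.ae_ae_of_ae_compProd (p := fun z : Env × (ℕ → ℤ) =>
      Tendsto (fun n : ℕ => (z.2 n : ℝ) / (n : ℝ)) atTop (𝓝 V⁻¹)) hlim
  exact hac'.ae_le h2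

end Speed

end MottWalk

/-! ### Assembly of the two regimes. -/

theorem mainTheorem4
    (P : Measure MottWalk.Env) (hP : MottWalk.IsEnvLaw P)
    (u : ℝ → ℝ → ℝ) (hu_meas : Measurable (Function.uncurry u))
    (hu_symm : ∀ a b : ℝ, u a b = u b a)
    (hu_bdd : ∃ umin umax : ℝ, ∀ a b : ℝ, umin ≤ u a b ∧ u a b ≤ umax)
    (lam : ℝ) (hlam0 : 0 ≤ lam) (hlam1 : lam < 1) :
    ∃ v : ℝ,
      (∀ᵐ ω ∂P, ∀ᵐ X ∂(MottWalk.walkLaw u lam 1 ω 0),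
        Tendsto (fun n : ℕ => (X n : ℝ) / (n : ℝ)) atTop (𝓝 v)) ∧
      (0 < v ↔ MottWalk.meanSeries P lam < ∞) ∧
      (¬ MottWalk.meanSeries P lam < ∞ → v = 0) := by
  have := hP.isProbabilityMeasure
  have hiff := MottWalk.lintegral_rightTime_lt_top_iff hP hu_symm hu_bdd hlam0 hlam1
  have hL := MottWalk.lintegral_leftTime_eq_top hP hu_bdd hlam0 hlam1
  have hpos : ∀ᵐ ω ∂P, ∀ k, 0 < MottWalk.totalConductance u lam ω k := by
    obtain ⟨umin, umax, hu⟩ := hu_bdd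
    obtain ⟨d, hd, hgap⟩ := hP.exists_ae_le_gap
    exact hgap.mono fun ω hω => MottWalk.totalConductance_pos hu hlam1 hd hω hlam0
  by_cases hfin : MottWalk.meanSeries P lam < ∞
  · have hR := hiff.2 hfin
    have hR0 : 0 < (∫⁻ ω, MottWalk.rightTime u lam ω ∂P).toReal := by
      refine ENNReal.toReal_pos ?_ hR.ne
      -- The mean is nonzero because it is also the mean of a density that is almost surely nonzero.
      rw [← MottWalk.lintegral_visitDensity hu_meas lam hP]
      intro h0
      rw [lintegral_eq_zero_iff (MottWalk.measurable_visitDensity hu_meas lam)] at h0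
      obtain ⟨ω, h1, h2⟩ := (h0.and hpos).exists
      exact MottWalk.visitDensity_ne_zero h2 h1
    exact ⟨_, MottWalk.ae_tendsto_of_rightTime_lt_top hP hu_meas hu_symm hpos hR hR0,
      ⟨fun _ => hfin, fun _ => inv_pos.2 hR0⟩, fun h => absurd hfin h⟩
  · have hR : ∫⁻ ω, MottWalk.rightTime u lam ω ∂P = ∞ := by
      rwa [← hiff, not_lt, top_le_iff] at hfin
    exact ⟨0, MottWalk.ae_tendsto_zero_of_rightTime_eq_top hP hu_meas hu_symm hpos hR hL,
      ⟨fun h => absurd h (lt_irrefl 0), fun h => absurd h hfin⟩, fun _ => rfl⟩
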